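/- Let $k$ be a commutative noetherian ring, let $A$ be a commutative $k$-algebra essentially of finite type (that is, a localization, at a multiplicative subset, of a finitely generated commutative $k$-algebra), and let $L$ be a finite $A$-algebra, i.e. an associative unital (not necessarily commutative) $A$-algebra which is finitely generated as an $A$-module. Then, for every $d\in\mathbb{N}$, the category $\mathcal{P}_{d;k}(L,k)$ of homogeneous strict polynomial functors of degree $d$ over $k$ is locally noetherian, i.e. it is generated by a set of noetherian objects (an object is noetherian if every increasing sequence of its subobjects stabilizes). Here the notions are the following. * For a $k$-module $V$, the divided power algebra $\Gamma^*_k(V)$ is the commutative unital $k$-algebra generated by symbols $v^{[n]}$ ($v\in V$, $n\in\mathbb{N}$) subject to the relations $v^{[0]}=1$, $(\lambda v)^{[n]}=\lambda^n v^{[n]}$, $v^{[m]}v^{[n]}=\binom{m+n}{m}v^{[m+n]}$ and $(v+w)^{[n]}=\sum_{i+j=n}v^{[i]}w^{[j]}$ (for $v,w\in V$, $\lambda\in k$, $m,n\in\mathbb{N}$). It is graded by $\deg v^{[n]}=n$, and $\Gamma^d_k(V)$ denotes its homogeneous component of degree $d$. * The functor $\Gamma^d_k$ is symmetric monoidal: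 there is a natural $k$-linear map $\Gamma^d_k(V)\otimes_k\Gamma^d_k(W)\to\Gamma^d_k(V\otimes_k W)$, which sends $v_1^{[a_1]}\cdots v_r^{[a_r]}\otimes w_1^{[b_1]}\cdots w_s^{[b_s]}$ (with $\sum_i a_i=\sum_j b_j=d$) to $\sum_{(m_{ij})}\prod_{i,j}(v_i\otimes w_j)^{[m_{ij}]}$, the sum being over all $r\times s$ matrices of natural numbers with row sums $a_i$ and column sums $b_j$. * For a $k$-linear category $\mathcal{C}$, the $k$-linear category $\Gamma^d_k\mathcal{C}$ has the same objects as $\mathcal{C}$, its morphisms from $a$ to $b$ are the elements of $\Gamma^d_k(\mathcal{C}(a,b))$, and its composition is $\Gamma^d_k(\mathcal{C}(a,b))\otimes_k\Gamma^d_k(\mathcal{C}(b,c))\to\Gamma^d_k(\mathcal{C}(a,b)\otimes_k\mathcal{C}(b,c))\to\Gamma^d_k(\mathcal{C}(a,c))$, where the first map is the one above and the second one is induced by the composition of $\mathcal{C}$. The identity of $a$ is $(\mathrm{id}_a)^{[d]}$. * $\mathbf{P}(L)$ is the (essentially small) $k$-linear category of finitely generated projective right $L$-modules, and $\mathcal{P}_{d;k}(L,k)$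 is the abelian category of $k$-linear functors from $\Gamma^d_k\mathbf{P}(L)$ to $k\text{-}\mathbf{Mod}$. -/

import Mathlib

/-!
# Divided powers

`DividedPowerAlgebra k V` is the commutative `k`-algebra `Γ*(V)` generated by symbols `dp k n v`
(written `v^[n]`), for `n : ℕ` and `v : V`, subject to `v^[0] = 1`, `(a v)^[n] = a ^ n v^[n]`,
`v^[m] v^[n] = (m + n).choose m v^[m + n]` and `(v + w)^[n] = ∑_{i + j = n} v^[i] w^[j]`.
We equip it with its grading, its bialgebra structure and, for a bilinear map
`β : V × W → U`, with the induced bilinear map `Γ*(V) × Γ*(W) → Γ*(U)`.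
-/

universe w v u v' u'

namespace DividedPowerAlgebra

noncomputable section

open TensorProduct
open Finset.HasAntidiagonal (antidiagonal mem_antidiagonal)

variable {k : Type*} [CommRing k]
variable {V : Type*} [AddCommGroup V] [Module k V]

lemma hom_ext {B : Type*} [Semiring B] [Algebra k B] {f g : DividedPowerAlgebra k V →ₐ[k] B}
    (h : ∀ n v, f (dp k n v) = g (dp k n v)) : f = g := by
  ext p
  exact h p.1 p.2

lemma sum_antidiagonal_choose_mul_choose {M : Type*} [AddCommMonoid M] (n p : ℕ) (t : ℕ → ℕ → M) :
    (∑ a ∈ antidiagonal n, ∑ b ∈ antidiagonal p,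
      ((a.1 + b.1).choose a.1 * (a.2 + b.2).choose a.2) • t (a.1 + b.1) (a.2 + b.2)) =
    (n + p).choose n • ∑ c ∈ antidiagonal (n + p), t c.1 c.2 := by
  classical
  rw [Finset.smul_sum]
  have h : ∀ c ∈ antidiagonal (n + p), (n + p).choose n • t c.1 c.2 =
      ∑ a ∈ antidiagonal n, (c.1.choose a.1 * c.2.choose a.2) • t c.1 c.2 := by
    intro c hc
    rw [← Finset.sum_smul, ← Nat.add_choose_eq, mem_antidiagonal.mp hc]
  rw [Finset.sum_congr rfl h]
  conv_rhs => rw [Finset.sum_comm]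
  refine Finset.sum_congr rfl fun a ha => ?_
  rw [mem_antidiagonal] at ha
  refine Finset.sum_bij_ne_zero (fun b _ _ => (a.1 + b.1, a.2 + b.2)) ?_ ?_ ?_ ?_
  · intro b hb _
    rw [mem_antidiagonal] at hb ⊢
    dsimp only; omega
  · rintro ⟨b1, b2⟩ _ _ ⟨c1, c2⟩ _ _ h
    simp only [Prod.mk.injEq] at h ⊢
    omega
  · rintro ⟨c1, c2⟩ hc h0
    rw [mem_antidiagonal] at hc
    dsimp only at hc h0
    have h1 : a.1 ≤ c1 := by
      by_contra hlt
      exact h0 (by rw [Nat.choose_eq_zero_of_lt (not_le.mp hlt)]; simp)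
    have h2 : a.2 ≤ c2 := by
      by_contra hlt
      exact h0 (by rw [Nat.choose_eq_zero_of_lt (not_le.mp hlt)]; simp)
    refine ⟨(c1 - a.1, c2 - a.2), ?_, ?_, ?_⟩
    · rw [mem_antidiagonal]; dsimp only; omega
    · dsimp only
      rwa [Nat.add_sub_cancel' h1, Nat.add_sub_cancel' h2]
    · dsimp only
      rw [Nat.add_sub_cancel' h1, Nat.add_sub_cancel' h2]
  · intro b _ _
    rfl

variable (k V) in
/-- The counit of `Γ*(V)`: `v^[n] ↦ 0` for `n > 0`. -/
def counitHom : DividedPowerAlgebra k V →ₐ[k] k :=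
  lift' (f := fun p => if p.1 = 0 then 1 else 0)
    (fun _ => by simp)
    (fun n r m => by by_cases h : n = 0 <;> simp [h])
    (fun n p m => by
      by_cases h : n = 0 <;> by_cases h' : p = 0 <;> simp [h, h'])
    (fun n u v => by
      by_cases h : n = 0
      · simp [h]
      · rw [if_neg h]
        symm
        refine Finset.sum_eq_zero fun a ha => ?_
        rw [mem_antidiagonal] at ha
        by_cases h1 : a.1 = 0
        · have : a.2 ≠ 0 := by omega
          simp [this]
        · simp [h1])

@[simp] lemma counitHom_dp (n : ℕ) (v : V) :
    counitHom k V (dp k n v) = if n = 0 then 1 else 0 := lift'_apply_dp ..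

lemma sum_antidiagonal_mul_mul_comm {R : Type*} [CommSemiring R] (a b c d : ℕ → R) (n : ℕ) :
    (∑ s ∈ antidiagonal n, (∑ i ∈ antidiagonal s.1, a i.1 * b i.2) *
      ∑ j ∈ antidiagonal s.2, c j.1 * d j.2) =
    ∑ s ∈ antidiagonal n, (∑ i ∈ antidiagonal s.1, a i.1 * c i.2) *
      ∑ j ∈ antidiagonal s.2, b j.1 * d j.2 := by
  have h := congr_arg (PowerSeries.coeff n) (mul_mul_mul_comm
    (PowerSeries.mk a) (PowerSeries.mk b) (PowerSeries.mk c) (PowerSeries.mk d))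
  simpa only [PowerSeries.coeff_mul, PowerSeries.coeff_mk] using h

lemma sum_antidiagonal_mul_assoc {R : Type*} [Semiring R] (a b c : ℕ → R) (n : ℕ) :
    (∑ s ∈ antidiagonal n, ∑ i ∈ antidiagonal s.1, a i.1 * b i.2 * c s.2) =
    ∑ s ∈ antidiagonal n, ∑ j ∈ antidiagonal s.2, a s.1 * (b j.1 * c j.2) := by
  have h := congr_arg (PowerSeries.coeff n) (mul_assoc
    (PowerSeries.mk a) (PowerSeries.mk b) (PowerSeries.mk c))
  simpa only [PowerSeries.coeff_mul, PowerSeries.coeff_mk, Finset.sum_mul, Finset.mul_sum] using h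

/-- The algebra map `v^[n] ↦ ∑_{i + j = n} φ (v^[i]) ψ (v^[j])`. -/
def convHom {B : Type*} [CommSemiring B] [Algebra k B] (φ ψ : DividedPowerAlgebra k V →ₐ[k] B) :
    DividedPowerAlgebra k V →ₐ[k] B :=
  lift' (f := fun p => ∑ a ∈ antidiagonal p.1, φ (dp k a.1 p.2) * ψ (dp k a.2 p.2))
    (fun _ => by simp [dp_zero])
    (fun n r m => by
      rw [Finset.smul_sum]
      refine Finset.sum_congr rfl fun a ha => ?_
      rw [dp_smul, dp_smul, map_smul, map_smul, smul_mul_smul_comm, ← pow_add,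
        mem_antidiagonal.mp ha])
    (fun n p m => by
      rw [Finset.sum_mul_sum]
      rw [← sum_antidiagonal_choose_mul_choose n p (fun i j => φ (dp k i m) * ψ (dp k j m))]
      refine Finset.sum_congr rfl fun a _ => Finset.sum_congr rfl fun b _ => ?_
      rw [mul_mul_mul_comm, ← map_mul, ← map_mul, dp_mul, dp_mul, map_nsmul, map_nsmul,
        smul_mul_smul_comm])
    (fun n u v => by
      simp only [dp_add, map_sum, map_mul]
      exact sum_antidiagonal_mul_mul_comm (R := B) (fun i => φ (dp k i u)) (fun i => φ (dp k i v))
        (fun i => ψ (dp k i u)) (fun i => ψ (dp k i v)) n)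

lemma convHom_dp {B : Type*} [CommSemiring B] [Algebra k B] (φ ψ : DividedPowerAlgebra k V →ₐ[k] B)
    (n : ℕ) (v : V) :
    convHom φ ψ (dp k n v) = ∑ a ∈ antidiagonal n, φ (dp k a.1 v) * ψ (dp k a.2 v) :=
  lift'_apply_dp ..

variable (k V) in
/-- The comultiplication of `Γ*(V)`: `v^[n] ↦ ∑_{i + j = n} v^[i] ⊗ v^[j]`. -/
def comulHom : DividedPowerAlgebra k V →ₐ[k] DividedPowerAlgebra k V ⊗[k] DividedPowerAlgebra k V :=
  convHom (B := DividedPowerAlgebra k V ⊗[k] DividedPowerAlgebra k V)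
    Algebra.TensorProduct.includeLeft Algebra.TensorProduct.includeRight

lemma comulHom_dp (n : ℕ) (v : V) :
    comulHom k V (dp k n v) = ∑ a ∈ antidiagonal n, dp k a.1 v ⊗ₜ[k] dp k a.2 v := by
  rw [comulHom, convHom_dp]
  refine Finset.sum_congr rfl fun a _ => ?_
  simp [Algebra.TensorProduct.tmul_mul_tmul]

instance : Bialgebra k (DividedPowerAlgebra k V) :=
  Bialgebra.ofAlgHom (comulHom k V) (counitHom k V)
    (by
      refine hom_ext (fun n v => ?_)
      have h := sum_antidiagonal_mul_assoc
        (R := DividedPowerAlgebra k V ⊗[k] (DividedPowerAlgebra k V ⊗[k] DividedPowerAlgebra k V))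
        (fun i => dp k i v ⊗ₜ[k] (1 ⊗ₜ[k] 1)) (fun i => 1 ⊗ₜ[k] (dp k i v ⊗ₜ[k] 1))
        (fun i => 1 ⊗ₜ[k] (1 ⊗ₜ[k] dp k i v)) n
      simp only [Algebra.TensorProduct.tmul_mul_tmul, one_mul, mul_one] at h
      simpa [comulHom_dp, TensorProduct.sum_tmul, TensorProduct.tmul_sum] using h)
    (by
      refine hom_ext (fun n v => ?_)
      simp only [AlgHom.comp_apply, comulHom_dp, map_sum, Algebra.TensorProduct.map_tmul,
        counitHom_dp, AlgHom.id_apply]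
      rw [Finset.sum_eq_single (0, n)]
      · simp
      · rintro ⟨i, j⟩ hij hne
        have : i ≠ 0 := by
          rintro rfl
          simp_all [mem_antidiagonal]
        simp [this]
      · simp [mem_antidiagonal])
    (by
      refine hom_ext (fun n v => ?_)
      simp only [AlgHom.comp_apply, comulHom_dp, map_sum, Algebra.TensorProduct.map_tmul,
        counitHom_dp, AlgHom.id_apply]
      rw [Finset.sum_eq_single (n, 0)]
      · simp
      · rintro ⟨i, j⟩ hij hne
        have : j ≠ 0 := by
          rintro rfl
          simp_all [mem_antidiagonal]
        simp [this]
      · simp [mem_antidiagonal])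

lemma comul_dp (n : ℕ) (v : V) : Coalgebra.comul (R := k) (dp k n v) =
    ∑ a ∈ antidiagonal n, dp k a.1 v ⊗ₜ[k] dp k a.2 v :=
  comulHom_dp n v

lemma counit_dp (n : ℕ) (v : V) : Coalgebra.counit (R := k) (dp k n v) =
    if n = 0 then 1 else 0 :=
  counitHom_dp n v

instance : Coalgebra.IsCocomm k (DividedPowerAlgebra k V) where
  comm_comp_comul := by
    have h : ((Algebra.TensorProduct.comm k (DividedPowerAlgebra k V)
        (DividedPowerAlgebra k V)) : _ →ₐ[k] _).comp (Bialgebra.comulAlgHom k _) =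
        Bialgebra.comulAlgHom k (DividedPowerAlgebra k V) := by
      refine hom_ext (fun n v => ?_)
      simp only [AlgHom.comp_apply, Bialgebra.comulAlgHom_apply, comul_dp, map_sum]
      rw [← Finset.Nat.sum_antidiagonal_swap]
      rfl
    exact congrArg AlgHom.toLinearMap h

variable (k V) in
/-- The algebra map `Γ*(V) → Γ*(V)[T]` with `v^[n] ↦ v^[n] T ^ n`, which records the degree. -/
def weight : DividedPowerAlgebra k V →ₐ[k] Polynomial (DividedPowerAlgebra k V) :=
  lift' (f := fun p => Polynomial.monomial p.1 (dp k p.1 p.2))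
    (fun _ => by simp [dp_zero])
    (fun n r m => by simp only [dp_smul, Polynomial.smul_monomial])
    (fun n p m => by
      simp only [Polynomial.monomial_mul_monomial, dp_mul, Polynomial.smul_monomial])
    (fun n u v => by
      rw [dp_add, map_sum]
      refine Finset.sum_congr rfl fun a ha => ?_
      dsimp only
      rw [Polynomial.monomial_mul_monomial, mem_antidiagonal.mp ha])

@[simp] lemma weight_dp (n : ℕ) (v : V) :
    weight k V (dp k n v) = Polynomial.monomial n (dp k n v) := lift'_apply_dp ..

variable (k V) in
/-- The projection of `Γ*(V)` onto its homogeneous component of degree `n`. -/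
def proj (n : ℕ) : DividedPowerAlgebra k V →ₗ[k] DividedPowerAlgebra k V :=
  ((Polynomial.lcoeff (DividedPowerAlgebra k V) n).restrictScalars k) ∘ₗ (weight k V).toLinearMap

lemma proj_apply (n : ℕ) (x : DividedPowerAlgebra k V) :
    proj k V n x = (weight k V x).coeff n := rfl

lemma proj_dp (n m : ℕ) (v : V) :
    proj k V n (dp k m v) = if m = n then dp k m v else 0 := by
  rw [proj_apply, weight_dp, Polynomial.coeff_monomial]

lemma proj_mul (n : ℕ) (x y : DividedPowerAlgebra k V) :
    proj k V n (x * y) = ∑ a ∈ antidiagonal n, proj k V a.1 x * proj k V a.2 y := by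
  simp only [proj_apply, map_mul, Polynomial.coeff_mul]

variable {W : Type*} [AddCommGroup W] [Module k W]
variable {U : Type*} [AddCommGroup U] [Module k U]

lemma proj_zero_eq (y : DividedPowerAlgebra k V) :
    proj k V 0 y = algebraMap k _ (Coalgebra.counit (R := k) y) := by
  have h : ((Polynomial.aeval (0 : DividedPowerAlgebra k V)).restrictScalars k).comp (weight k V) =
      (Algebra.ofId k (DividedPowerAlgebra k V)).comp (Bialgebra.counitAlgHom k _) := by
    refine hom_ext (fun n v => ?_)
    by_cases hn : n = 0 <;> simp [hn, counit_dp, dp_zero, Polynomial.aeval_def, Polynomial.eval₂_monomial, Algebra.ofId_apply]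
  have h2 := DFunLike.congr_fun h y
  simpa [Polynomial.coeff_zero_eq_aeval_zero', proj_apply, Algebra.ofId_apply, Polynomial.aeval_def, Polynomial.coeff_zero_eq_eval_zero] using h2

lemma proj_map (g : V →ₗ[k] W) (n : ℕ) (y : DividedPowerAlgebra k V) :
    proj k W n (map k g y) = map k g (proj k V n y) := by
  have h : (weight k W).comp (map k g) = (Polynomial.mapAlgHom (map k g)).comp (weight k V) := by
    refine hom_ext (fun n v => ?_)
    simp [Polynomial.map_monomial]
  have h2 := congr_arg (fun p => Polynomial.coeff p n) (DFunLike.congr_fun h y)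
  simpa [proj_apply] using h2

lemma map_smul_proj (g : V →ₗ[k] W) (r : k) (n : ℕ) (y : DividedPowerAlgebra k V) :
    map k (r • g) (proj k V n y) = r ^ n • map k g (proj k V n y) := by
  have h : (weight k W).comp (map k (r • g)) =
      (((Polynomial.aeval (Polynomial.C (algebraMap k _ r) * Polynomial.X :
        Polynomial (DividedPowerAlgebra k W))).restrictScalars k).comp
        (weight k W)).comp (map k g) := by
    refine hom_ext (fun n v => ?_)
    simp only [AlgHom.comp_apply, map_apply_dp, LinearMap.smul_apply, dp_smul, map_smul, weight_dp,
      AlgHom.restrictScalars_apply, Polynomial.aeval_monomial, mul_pow, ← Polynomial.C_pow,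
      ← map_pow]
    rw [Polynomial.algebraMap_eq, mul_pow (M := Polynomial (DividedPowerAlgebra k W)), ← mul_assoc, ← Polynomial.C_pow, ← Polynomial.C_mul,
      Polynomial.C_mul_X_pow_eq_monomial, mul_comm, ← map_pow, ← Algebra.smul_def,
      Polynomial.smul_monomial]
  have h2 := congr_arg (fun p => Polynomial.coeff p n) (DFunLike.congr_fun h y)
  rw [← proj_map, ← proj_map]
  simp only [AlgHom.comp_apply, ← proj_apply] at h2
  rw [h2, proj_apply]
  simp [Polynomial.aeval_def, ← Polynomial.comp.eq_1, Polynomial.comp_C_mul_X_coeff, Algebra.smul_def, mul_comm]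

variable (k V) in
/-- The linear map `x ⊗ y ↦ x_n y_p`. -/
def mulProj (n p : ℕ) : DividedPowerAlgebra k V ⊗[k] DividedPowerAlgebra k V →ₗ[k]
    DividedPowerAlgebra k V :=
  LinearMap.mul' k _ ∘ₗ TensorProduct.map (proj k V n) (proj k V p)

lemma mulProj_tmul (n p : ℕ) (x y : DividedPowerAlgebra k V) :
    mulProj k V n p (x ⊗ₜ[k] y) = proj k V n x * proj k V p y := rfl

lemma mulProj_mul (n p : ℕ) (s t : DividedPowerAlgebra k V ⊗[k] DividedPowerAlgebra k V) :
    mulProj k V n p (s * t) = ∑ a ∈ antidiagonal n, ∑ b ∈ antidiagonal p,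
      mulProj k V a.1 b.1 s * mulProj k V a.2 b.2 t := by
  induction s with
  | zero => simp
  | add s s' hs hs' => simp only [add_mul, map_add, hs, hs', Finset.sum_add_distrib]
  | tmul x y =>
    induction t with
    | zero => simp
    | add t t' ht ht' => simp only [mul_add, map_add, ht, ht', Finset.sum_add_distrib]
    | tmul x' y' =>
      rw [Algebra.TensorProduct.tmul_mul_tmul, mulProj_tmul, proj_mul, proj_mul, Finset.sum_mul_sum]
      refine Finset.sum_congr rfl fun a _ => Finset.sum_congr rfl fun b _ => ?_
      rw [mulProj_tmul, mulProj_tmul, mul_mul_mul_comm]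

lemma mulProj_comul_dp (n p m : ℕ) (v : V) :
    mulProj k V n p (Coalgebra.comul (R := k) (dp k m v)) =
      (n + p).choose n • proj k V (n + p) (dp k m v) := by
  rw [comul_dp, map_sum, proj_dp]
  simp only [mulProj_tmul, proj_dp]
  split_ifs with h
  · subst h
    rw [Finset.sum_eq_single (n, p), if_pos rfl, if_pos rfl, dp_mul]
    · rintro ⟨i, j⟩ hij hne
      rw [mem_antidiagonal] at hij
      by_cases hi : i = n
      · subst hi
        exact absurd (by simp at hij; simp [hij]) hne
      · rw [if_neg hi, zero_mul]
    · simp [mem_antidiagonal]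
  · rw [smul_zero]
    refine Finset.sum_eq_zero fun a ha => ?_
    rw [mem_antidiagonal] at ha
    by_cases h1 : a.1 = n
    · rw [if_neg (show a.2 ≠ p by omega), mul_zero]
    · rw [if_neg h1, zero_mul]

lemma mulProj_comul (n p : ℕ) (y : DividedPowerAlgebra k V) :
    mulProj k V n p (Coalgebra.comul (R := k) y) = (n + p).choose n • proj k V (n + p) y := by
  induction y using DividedPowerAlgebra.induction_on generalizing n p with
  | C a =>
    have h := mulProj_comul_dp n p 0 (0 : V) (k := k)
    rw [dp_zero] at h
    rw [Algebra.algebraMap_eq_smul_one]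
    simp only [map_smul, h]
    rw [smul_comm]
  | add f g hf hg => simp only [map_add, hf, hg, smul_add]
  | dp f m v hf =>
    rw [Bialgebra.comul_mul, mulProj_mul, proj_mul,
      ← sum_antidiagonal_choose_mul_choose n p (fun i j => proj k V i f * proj k V j (dp k m v))]
    refine Finset.sum_congr rfl fun a _ => Finset.sum_congr rfl fun b _ => ?_
    rw [hf, mulProj_comul_dp, smul_mul_smul_comm]

variable (k) in
/-- The algebra map `x ⊗ y ↦ Γ(f)(x) Γ(g)(y)`, with the degree recorded by powers of `T`. -/
def mapHom₂ (f g : V →ₗ[k] W) :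
    DividedPowerAlgebra k V ⊗[k] DividedPowerAlgebra k V →ₐ[k]
      Polynomial (DividedPowerAlgebra k W) :=
  Algebra.TensorProduct.lift ((weight k W).comp (map k f)) ((weight k W).comp (map k g))
    (fun a b => show _ * _ = _ * _ from mul_comm (G := Polynomial (DividedPowerAlgebra k W)) _ _)

lemma mapHom₂_tmul (f g : V →ₗ[k] W) (x y : DividedPowerAlgebra k V) :
    mapHom₂ k f g (x ⊗ₜ[k] y) = weight k W (map k f x) * weight k W (map k g y) :=
  Algebra.TensorProduct.lift_tmul ..

lemma mapHom₂_comul (f g : V →ₗ[k] W) (y : DividedPowerAlgebra k V) :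
    mapHom₂ k f g (Coalgebra.comul (R := k) y) = weight k W (map k (f + g) y) := by
  have h : (mapHom₂ k f g).comp (Bialgebra.comulAlgHom k (DividedPowerAlgebra k V)) =
      (weight k W).comp (map k (f + g)) := by
    refine hom_ext (fun m v => ?_)
    simp only [AlgHom.comp_apply, Bialgebra.comulAlgHom_apply, comul_dp, map_sum,
      mapHom₂_tmul, map_apply_dp, weight_dp, LinearMap.add_apply,
      Polynomial.monomial_mul_monomial]
    rw [dp_add, map_sum]
    refine Finset.sum_congr rfl fun a ha => ?_
    rw [mem_antidiagonal.mp ha]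
  exact DFunLike.congr_fun h y

lemma map_add_proj (f g : V →ₗ[k] W) (n : ℕ) (y : DividedPowerAlgebra k V) :
    map k (f + g) (proj k V n y) = ∑ a ∈ antidiagonal n, LinearMap.mul' k _ (TensorProduct.map
      ((map k f).toLinearMap ∘ₗ proj k V a.1) ((map k g).toLinearMap ∘ₗ proj k V a.2)
      (Coalgebra.comul (R := k) y)) := by
  have h1 : ∀ t : DividedPowerAlgebra k V ⊗[k] DividedPowerAlgebra k V,
      (mapHom₂ k f g t).coeff n = ∑ a ∈ antidiagonal n, LinearMap.mul' k _
      (TensorProduct.map ((map k f).toLinearMap ∘ₗ proj k V a.1)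
        ((map k g).toLinearMap ∘ₗ proj k V a.2) t) := by
    intro t
    induction t with
    | zero => simp
    | add a b ha hb => simp only [map_add, Polynomial.coeff_add, ha, hb, Finset.sum_add_distrib]
    | tmul a b =>
      rw [mapHom₂_tmul, Polynomial.coeff_mul]
      refine Finset.sum_congr rfl fun s _ => ?_
      simp only [TensorProduct.map_tmul, LinearMap.mul'_apply, LinearMap.comp_apply,
        AlgHom.toLinearMap_apply, ← proj_map]
      rfl
  rw [← h1, ← proj_map, mapHom₂_comul]
  rfl

variable (k V) in
/-- The homogeneous component `Γ^d(V)` of degree `d` of `Γ*(V)`, where `v^[n]` has degree `n`: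
the span of the monomials `v₁^[n₁] ⋯ v_r^[n_r]` with `n₁ + ⋯ + n_r = d`. -/
def homogeneous (d : ℕ) : Submodule k (DividedPowerAlgebra k V) :=
  Submodule.span k {x | ∃ s : Multiset (ℕ × V), (s.map Prod.fst).sum = d ∧
    x = (s.map fun p => dp k p.1 p.2).prod}

lemma mul'_map_comp {A : Type*} [AddCommMonoid A] [Module k A] (g : V →ₗ[k] W)
    (a b : A →ₗ[k] DividedPowerAlgebra k V) (t : A ⊗[k] A) :
    LinearMap.mul' k _ (TensorProduct.map ((map k g).toLinearMap ∘ₗ a)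
      ((map k g).toLinearMap ∘ₗ b) t) =
    map k g (LinearMap.mul' k _ (TensorProduct.map a b t)) := by
  induction t with
  | zero => simp
  | add x y hx hy => simp only [map_add, hx, hy]
  | tmul x y => simp

/-- For a bilinear map `β`, the map `x ↦ (y ↦ x * y)` from `Γ*(V)` to the linear maps
`Γ*(W) → Γ*(U)`, given by `v^[n] * y = Γ(β v) (y_n)` with `y_n` the component of `y` of degree `n`,
and by `(x x') * y = ∑ (x * y₍₁₎) (x' * y₍₂₎)` with `∑ y₍₁₎ ⊗ y₍₂₎` the comultiplication of `y`;
the last rule says that it is an algebra map for the convolution product. Explicitly,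
`(∏ i, v_i^[a_i]) * (∏ j, w_j^[b_j])` is the sum of `∏ i j, (β v_i w_j)^[m_ij]` over the matrices
`m` of natural numbers with row sums `a_i` and column sums `b_j`. In degree `d` this is the
composite of the monoidal structure map `Γ^d(V) ⊗ Γ^d(W) → Γ^d(V ⊗ W)` and of `Γ^d(β)`. -/
def pair (β : V →ₗ[k] W →ₗ[k] U) : DividedPowerAlgebra k V →ₐ[k]
    WithConv (DividedPowerAlgebra k W →ₗ[k] DividedPowerAlgebra k U) :=
  lift' (f := fun p => WithConv.toConv ((map k (β p.2)).toLinearMap ∘ₗ proj k W p.1))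
    (fun v => by
      ext y
      simp [proj_zero_eq])
    (fun n r v => by
      ext y
      simp [map_smul_proj])
    (fun n p v => by
      ext y
      rw [LinearMap.convMul_apply]
      refine (mul'_map_comp _ _ _ _).trans ?_
      refine (congrArg _ (mulProj_comul n p y)).trans ?_
      rw [map_nsmul, ← Nat.cast_smul_eq_nsmul k, ← Nat.cast_smul_eq_nsmul k]
      rfl)
    (fun n u v => by
      ext y
      rw [map_add]
      refine (map_add_proj _ _ n y).trans ?_
      simp [WithConv.ofConv_sum])

lemma pair_dp (β : V →ₗ[k] W →ₗ[k] U) (n : ℕ) (v : V) (y : DividedPowerAlgebra k W) :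
    pair β (dp k n v) y = map k (β v) (proj k W n y) := by
  rw [pair, lift'_apply_dp]
  rfl

lemma pair_algebraMap (β : V →ₗ[k] W →ₗ[k] U) (a : k) (y : DividedPowerAlgebra k W) :
    pair β (algebraMap k _ a) y = a • algebraMap k _ (Coalgebra.counit (R := k) y) := by
  rw [AlgHom.commutes, LinearMap.convAlgebraMap_apply]


variable {X Y : Type*} [AddCommGroup X] [Module k X] [AddCommGroup Y] [Module k Y]

lemma induction_dp {P : DividedPowerAlgebra k V → Prop} (x : DividedPowerAlgebra k V)
    (h_dp : ∀ n v, P (dp k n v)) (h_add : ∀ f g, P f → P g → P (f + g))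
    (h_smul : ∀ (a : k) f, P f → P (a • f))
    (h_mul : ∀ f n v, P f → P (f * dp k n v)) : P x := by
  induction x using DividedPowerAlgebra.induction_on with
  | C a =>
    rw [Algebra.algebraMap_eq_smul_one, ← dp_zero (R := k) (m := (0 : V))]
    exact h_smul _ _ (h_dp 0 0)
  | add f g hf hg => exact h_add f g hf hg
  | dp f n v hf => exact h_mul f n v hf

lemma dp_mem_homogeneous (n : ℕ) (v : V) : dp k n v ∈ homogeneous k V n :=
  Submodule.subset_span ⟨{(n, v)}, by simp, by simp⟩

lemma one_mem_homogeneous : (1 : DividedPowerAlgebra k V) ∈ homogeneous k V 0 :=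
  Submodule.subset_span ⟨0, by simp, by simp⟩

lemma mul_mem_homogeneous {m n : ℕ} {x y : DividedPowerAlgebra k V} (hx : x ∈ homogeneous k V m)
    (hy : y ∈ homogeneous k V n) : x * y ∈ homogeneous k V (m + n) := by
  refine (?_ : homogeneous k V m * homogeneous k V n ≤ homogeneous k V (m + n))
    (Submodule.mul_mem_mul hx hy)
  rw [homogeneous, homogeneous, Submodule.span_mul_span, Submodule.span_le]
  rintro _ ⟨_, ⟨s, hs, rfl⟩, _, ⟨t, ht, rfl⟩, rfl⟩
  exact Submodule.subset_span ⟨s + t, by simp [hs, ht], by simp⟩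

lemma weight_of_mem {d : ℕ} {x : DividedPowerAlgebra k V} (hx : x ∈ homogeneous k V d) :
    weight k V x = Polynomial.monomial d x := by
  induction hx using Submodule.span_induction with
  | mem x hx =>
    obtain ⟨s, rfl, rfl⟩ := hx
    induction s using Multiset.induction_on with
    | empty => simp
    | cons a s ih =>
      rw [Multiset.map_cons, Multiset.prod_cons, map_mul, ih, weight_dp,
        Polynomial.monomial_mul_monomial, Multiset.map_cons, Multiset.sum_cons]
  | zero => simp
  | add x y _ _ hx hy => rw [map_add, hx, hy, map_add]
  | smul a x _ hx => rw [map_smul, hx, Polynomial.smul_monomial]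

lemma proj_of_mem {d : ℕ} {x : DividedPowerAlgebra k V} (hx : x ∈ homogeneous k V d) (n : ℕ) :
    proj k V n x = if d = n then x else 0 := by
  rw [proj_apply, weight_of_mem hx, Polynomial.coeff_monomial]

lemma proj_mem (n : ℕ) (x : DividedPowerAlgebra k V) : proj k V n x ∈ homogeneous k V n := by
  induction x using induction_dp generalizing n with
  | h_dp m v =>
    rw [proj_dp]
    split_ifs with h
    · exact h ▸ dp_mem_homogeneous m v
    · exact zero_mem _
  | h_add f g hf hg => rw [map_add]; exact add_mem (hf n) (hg n)
  | h_smul a f hf => rw [map_smul]; exact Submodule.smul_mem _ _ (hf n)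
  | h_mul f m v hf =>
    rw [proj_mul]
    refine Submodule.sum_mem _ fun a ha => ?_
    rw [← mem_antidiagonal.mp ha]
    refine mul_mem_homogeneous (hf _) ?_
    rw [proj_dp]
    split_ifs with h
    · exact h ▸ dp_mem_homogeneous m v
    · exact zero_mem _

variable (k V) in
/-- The projection of `Γ*(V) ⊗ Γ*(V)` onto its component of total degree `n`. -/
def projT (n : ℕ) : DividedPowerAlgebra k V ⊗[k] DividedPowerAlgebra k V →ₗ[k]
    DividedPowerAlgebra k V ⊗[k] DividedPowerAlgebra k V :=
  ∑ a ∈ antidiagonal n, TensorProduct.map (proj k V a.1) (proj k V a.2)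

lemma projT_tmul (n : ℕ) (x y : DividedPowerAlgebra k V) :
    projT k V n (x ⊗ₜ[k] y) = ∑ a ∈ antidiagonal n, proj k V a.1 x ⊗ₜ[k] proj k V a.2 y := by
  simp [projT, LinearMap.sum_apply]

lemma projT_mul (n : ℕ) (s t : DividedPowerAlgebra k V ⊗[k] DividedPowerAlgebra k V) :
    projT k V n (s * t) = ∑ a ∈ antidiagonal n, projT k V a.1 s * projT k V a.2 t := by
  induction s with
  | zero => simp
  | add s s' hs hs' => simp only [add_mul, map_add, hs, hs', Finset.sum_add_distrib]
  | tmul x y =>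
    induction t with
    | zero => simp
    | add t t' ht ht' => simp only [mul_add, map_add, ht, ht', Finset.sum_add_distrib]
    | tmul x' y' =>
      have h := sum_antidiagonal_mul_mul_comm
        (R := DividedPowerAlgebra k V ⊗[k] DividedPowerAlgebra k V)
        (fun i => proj k V i x ⊗ₜ[k] 1) (fun i => proj k V i x' ⊗ₜ[k] 1)
        (fun i => 1 ⊗ₜ[k] proj k V i y) (fun i => 1 ⊗ₜ[k] proj k V i y') n
      simp only [Algebra.TensorProduct.tmul_mul_tmul, one_mul, mul_one] at h
      simp only [Algebra.TensorProduct.tmul_mul_tmul, projT_tmul, proj_mul]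
      refine Eq.trans (Finset.sum_congr rfl fun a _ => ?_) h
      rw [← TensorProduct.sum_tmul, ← TensorProduct.tmul_sum,
        Algebra.TensorProduct.tmul_mul_tmul, one_mul, mul_one]

lemma comul_proj (n : ℕ) (x : DividedPowerAlgebra k V) :
    Coalgebra.comul (R := k) (proj k V n x) = projT k V n (Coalgebra.comul (R := k) x) := by
  have base : ∀ (n m : ℕ) (v : V), Coalgebra.comul (R := k) (proj k V n (dp k m v)) =
      projT k V n (Coalgebra.comul (R := k) (dp k m v)) := by
    intro n m v
    rw [comul_dp, map_sum]
    simp only [projT_tmul, proj_dp]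
    split_ifs with h
    · subst h
      rw [comul_dp]
      refine Finset.sum_congr rfl fun a ha => ?_
      rw [Finset.sum_eq_single a]
      · simp
      · rintro b hb hne
        by_cases h1 : a.1 = b.1
        · have h2 : a.2 ≠ b.2 := fun h2 => hne (Prod.ext h1.symm h2.symm)
          rw [if_neg h2, TensorProduct.tmul_zero]
        · rw [if_neg h1, TensorProduct.zero_tmul]
      · exact fun h => absurd ha h
    · rw [map_zero]
      symm
      refine Finset.sum_eq_zero fun a ha => Finset.sum_eq_zero fun b hb => ?_
      rw [mem_antidiagonal] at ha hb
      by_cases h1 : a.1 = b.1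
      · rw [if_neg (show a.2 ≠ b.2 by omega), TensorProduct.tmul_zero]
      · rw [if_neg h1, TensorProduct.zero_tmul]
  induction x using induction_dp generalizing n with
  | h_dp m v => exact base n m v
  | h_add f g hf hg => simp only [map_add, hf, hg]
  | h_smul a f hf => simp only [map_smul, hf]
  | h_mul f m v hf =>
    rw [proj_mul, map_sum, Bialgebra.comul_mul, projT_mul]
    refine Finset.sum_congr rfl fun a _ => ?_
    rw [Bialgebra.comul_mul, hf, base]

lemma comul_map (g : V →ₗ[k] W) (x : DividedPowerAlgebra k V) :
    Coalgebra.comul (R := k) (map k g x) =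
      TensorProduct.map (map k g).toLinearMap (map k g).toLinearMap
        (Coalgebra.comul (R := k) x) := by
  have h : (Bialgebra.comulAlgHom k (DividedPowerAlgebra k W)).comp (map k g) =
      (Algebra.TensorProduct.map (map k g) (map k g)).comp
        (Bialgebra.comulAlgHom k (DividedPowerAlgebra k V)) := by
    refine hom_ext (fun n v => ?_)
    simp [comul_dp]
  exact DFunLike.congr_fun h x

/-- The map `pair β` as a bilinear map `Γ*(V) × Γ*(W) → Γ*(U)`. -/
def pairL (β : V →ₗ[k] W →ₗ[k] U) : DividedPowerAlgebra k V →ₗ[k]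
    DividedPowerAlgebra k W →ₗ[k] DividedPowerAlgebra k U where
  toFun x := (pair β x).ofConv
  map_add' x y := by rw [map_add]; rfl
  map_smul' a x := by rw [map_smul]; rfl

lemma pairL_dp (β : V →ₗ[k] W →ₗ[k] U) (n : ℕ) (v : V) (y : DividedPowerAlgebra k W) :
    pairL β (dp k n v) y = map k (β v) (proj k W n y) := pair_dp β n v y

lemma pairL_mul (β : V →ₗ[k] W →ₗ[k] U) (x x' : DividedPowerAlgebra k V)
    (y : DividedPowerAlgebra k W) :
    pairL β (x * x') y = LinearMap.mul' k _
      (TensorProduct.map (pairL β x) (pairL β x') (Coalgebra.comul (R := k) y)) := by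
  change (pair β (x * x')) y = _
  rw [map_mul]
  rfl

lemma pairL_dp_dp (β : V →ₗ[k] W →ₗ[k] U) (n : ℕ) (v : V) (w : W) :
    pairL β (dp k n v) (dp k n w) = dp k n (β v w) := by
  rw [pairL_dp, proj_dp, if_pos rfl, map_apply_dp]

lemma pairL_map (β : X →ₗ[k] W →ₗ[k] U) (γ : V →ₗ[k] W →ₗ[k] Y) (f : V →ₗ[k] X) (g : Y →ₗ[k] U)
    (h : ∀ v w, β (f v) w = g (γ v w)) (x : DividedPowerAlgebra k V)
    (y : DividedPowerAlgebra k W) : pairL β (map k f x) y = map k g (pairL γ x y) := by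
  induction x using induction_dp generalizing y with
  | h_dp n v =>
    rw [map_apply_dp, pairL_dp, pairL_dp, show β (f v) = g ∘ₗ γ v from LinearMap.ext (h v),
      map_comp]
    rfl
  | h_add a b ha hb => simp only [map_add, LinearMap.add_apply, ha, hb]
  | h_smul c a ha => simp only [map_smul, LinearMap.smul_apply, ha]
  | h_mul a n v ha =>
    rw [map_mul, pairL_mul, pairL_mul, ← mul'_map_comp]
    congr 3
    · exact LinearMap.ext ha
    · ext z
      rw [map_apply_dp, pairL_dp, show β (f v) = g ∘ₗ γ v from LinearMap.ext (h v), map_comp,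
        LinearMap.comp_apply, pairL_dp]
      rfl

lemma proj_pairL (β : V →ₗ[k] W →ₗ[k] U) (n : ℕ) (x : DividedPowerAlgebra k V)
    (y : DividedPowerAlgebra k W) : proj k U n (pairL β x y) = pairL β (proj k V n x) y := by
  have base : ∀ (n m : ℕ) (v : V) (y : DividedPowerAlgebra k W),
      proj k U n (pairL β (dp k m v) y) = pairL β (proj k V n (dp k m v)) y := by
    intro n m v y
    rw [pairL_dp, proj_map, proj_of_mem (proj_mem m y), proj_dp]
    split_ifs
    · rw [pairL_dp]
    · simp
  induction x using induction_dp generalizing n y with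
  | h_dp m v => exact base n m v y
  | h_add a b ha hb => simp only [map_add, LinearMap.add_apply, ha, hb]
  | h_smul c a ha => simp only [map_smul, LinearMap.smul_apply, ha]
  | h_mul a m v ha =>
    rw [pairL_mul, proj_mul, map_sum, LinearMap.sum_apply]
    simp only [pairL_mul]
    generalize (Coalgebra.comul (R := k) y) = t
    induction t with
    | zero => simp
    | add s s' hs hs' => simp only [map_add, hs, hs', Finset.sum_add_distrib]
    | tmul c d =>
      simp only [TensorProduct.map_tmul, LinearMap.mul'_apply, proj_mul, ha, base]

lemma pairL_mem (β : V →ₗ[k] W →ₗ[k] U) {n : ℕ} {x : DividedPowerAlgebra k V}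
    (hx : x ∈ homogeneous k V n) (y : DividedPowerAlgebra k W) :
    pairL β x y ∈ homogeneous k U n := by
  have h := proj_mem n (pairL β x y)
  rwa [proj_pairL, proj_of_mem hx, if_pos rfl] at h

lemma pairL_left_unit (β : V →ₗ[k] W →ₗ[k] W) (e : V) (he : ∀ w, β e w = w) {n : ℕ}
    {y : DividedPowerAlgebra k W} (hy : y ∈ homogeneous k W n) : pairL β (dp k n e) y = y := by
  rw [pairL_dp, proj_of_mem hy, if_pos rfl, show β e = LinearMap.id from LinearMap.ext he, map_id]
  rfl

lemma pairL_right (β : V →ₗ[k] W →ₗ[k] V) (e : W) (he : ∀ v, β v e = v) (n : ℕ)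
    (x : DividedPowerAlgebra k V) : pairL β x (dp k n e) = proj k V n x := by
  have base : ∀ (n m : ℕ) (v : V), pairL β (dp k m v) (dp k n e) = proj k V n (dp k m v) := by
    intro n m v
    rw [pairL_dp, proj_dp, proj_dp]
    by_cases h : n = m
    · subst h; simp [he]
    · rw [if_neg h, if_neg (Ne.symm h), map_zero]
  induction x using induction_dp generalizing n with
  | h_dp m v => exact base n m v
  | h_add a b ha hb => simp only [map_add, LinearMap.add_apply, ha, hb]
  | h_smul c a ha => simp only [map_smul, LinearMap.smul_apply, ha]
  | h_mul a m v ha =>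
    rw [pairL_mul, proj_mul, comul_dp, map_sum, map_sum]
    simp only [TensorProduct.map_tmul, LinearMap.mul'_apply, ha, base]

/-- Composition with an algebra map is an algebra map for the convolution product. -/
def convPostcomp {A B C : Type*} [AddCommMonoid C] [Module k C] [Coalgebra k C]
    [Semiring A] [Algebra k A] [Semiring B] [Algebra k B] (h : A →ₐ[k] B) :
    WithConv (C →ₗ[k] A) →ₐ[k] WithConv (C →ₗ[k] B) :=
  AlgHom.ofLinearMap
    { toFun := fun f => WithConv.toConv (h.toLinearMap ∘ₗ f.ofConv)
      map_add' := fun f g => by ext; simp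
      map_smul' := fun a f => by ext; simp }
    (by ext; simp)
    (fun f g => by
      ext c
      exact DFunLike.congr_fun (LinearMap.algHom_comp_convMul_distrib h f g) c)

/-- The algebra map `a ⊗ b ↦ f a * g b` into a convolution algebra. -/
def convLift {A B C : Type*} [Semiring A] [Algebra k A] [CommSemiring B] [Algebra k B]
    [AddCommMonoid C] [Module k C] [Coalgebra k C] [Coalgebra.IsCocomm k C]
    (f g : A →ₐ[k] WithConv (C →ₗ[k] B)) : A ⊗[k] A →ₐ[k] WithConv (C →ₗ[k] B) :=
  Algebra.TensorProduct.lift f g (fun _ _ => Commute.all _ _)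

lemma convLift_tmul {A B C : Type*} [Semiring A] [Algebra k A] [CommSemiring B] [Algebra k B]
    [AddCommMonoid C] [Module k C] [Coalgebra k C] [Coalgebra.IsCocomm k C]
    (f g : A →ₐ[k] WithConv (C →ₗ[k] B)) (a b : A) (c : C) :
    convLift f g (a ⊗ₜ[k] b) c = LinearMap.mul' k B
      (TensorProduct.map (f a).ofConv (g b).ofConv (Coalgebra.comul (R := k) c)) := by
  rw [convLift, Algebra.TensorProduct.lift_tmul, LinearMap.convMul_apply]

/-- The action of `Γ*(V) ⊗ Γ*(V)` on `Γ*(W)` through the comultiplication. -/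
def pairT (β : V →ₗ[k] W →ₗ[k] U) :
    DividedPowerAlgebra k V ⊗[k] DividedPowerAlgebra k V →ₐ[k]
      WithConv (DividedPowerAlgebra k W →ₗ[k] DividedPowerAlgebra k U ⊗[k] DividedPowerAlgebra k U) :=
  convLift (B := DividedPowerAlgebra k U ⊗[k] DividedPowerAlgebra k U)
    ((convPostcomp Algebra.TensorProduct.includeLeft).comp (pair β))
    ((convPostcomp Algebra.TensorProduct.includeRight).comp (pair β))

lemma pairT_apply (β : V →ₗ[k] W →ₗ[k] U)
    (t : DividedPowerAlgebra k V ⊗[k] DividedPowerAlgebra k V) (y : DividedPowerAlgebra k W) :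
    pairT β t y = TensorProduct.map₂ (pairL β) (pairL β) t (Coalgebra.comul (R := k) y) := by
  induction t with
  | zero => simp
  | add s s' hs hs' =>
    rw [map_add, map_add, LinearMap.add_apply, ← hs, ← hs']
    rfl
  | tmul a b =>
    refine (convLift_tmul (B := DividedPowerAlgebra k U ⊗[k] DividedPowerAlgebra k U)
      _ _ a b y).trans ?_
    generalize (Coalgebra.comul (R := k) y) = t
    induction t with
    | zero => simp
    | add s s' hs hs' => simp only [map_add, hs, hs']
    | tmul c d =>
      rw [TensorProduct.map_tmul, LinearMap.mul'_apply, TensorProduct.map₂_apply_tmul,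
        TensorProduct.map_tmul]
      change (pairL β a c ⊗ₜ[k] 1) * (1 ⊗ₜ[k] pairL β b d) = _
      rw [Algebra.TensorProduct.tmul_mul_tmul, one_mul, mul_one]

lemma comul_pairL (β : V →ₗ[k] W →ₗ[k] U) (x : DividedPowerAlgebra k V)
    (y : DividedPowerAlgebra k W) :
    Coalgebra.comul (R := k) (pairL β x y) = TensorProduct.map₂ (pairL β) (pairL β)
      (Coalgebra.comul (R := k) x) (Coalgebra.comul (R := k) y) := by
  have h : (convPostcomp (Bialgebra.comulAlgHom k (DividedPowerAlgebra k U))).comp (pair β) =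
      (pairT β).comp (Bialgebra.comulAlgHom k (DividedPowerAlgebra k V)) := by
    refine hom_ext (fun n v => ?_)
    ext y
    change Coalgebra.comul (R := k) (pairL β (dp k n v) y) =
      pairT β (Coalgebra.comul (R := k) (dp k n v)) y
    rw [pairT_apply, pairL_dp, comul_map, comul_proj, comul_dp, map_sum, LinearMap.sum_apply,
      projT, LinearMap.sum_apply, map_sum]
    refine Finset.sum_congr rfl fun a _ => ?_
    generalize (Coalgebra.comul (R := k) y) = t
    induction t with
    | zero => simp
    | add s s' hs hs' => simp only [map_add, hs, hs']
    | tmul c d =>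
      simp only [TensorProduct.map_tmul, TensorProduct.map₂_apply_tmul, pairL_dp,
        AlgHom.toLinearMap_apply]
  rw [← pairT_apply]
  exact congr_arg (fun f => f.ofConv y) (DFunLike.congr_fun h x)

lemma pairL_assoc (β₁ : V →ₗ[k] W →ₗ[k] X) (β₂ : X →ₗ[k] U →ₗ[k] Y)
    {Z : Type*} [AddCommGroup Z] [Module k Z]
    (β₃ : W →ₗ[k] U →ₗ[k] Z) (β₄ : V →ₗ[k] Z →ₗ[k] Y)
    (h : ∀ v w u, β₂ (β₁ v w) u = β₄ v (β₃ w u)) (x : DividedPowerAlgebra k V)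
    (y : DividedPowerAlgebra k W) (z : DividedPowerAlgebra k U) :
    pairL β₂ (pairL β₁ x y) z = pairL β₄ x (pairL β₃ y z) := by
  have base : ∀ n v y z,
      pairL β₂ (pairL β₁ (dp k n v) y) z = pairL β₄ (dp k n v) (pairL β₃ y z) := by
    intro n v y z
    rw [pairL_dp, pairL_dp, proj_pairL, pairL_map β₂ β₃ (β₁ v) (β₄ v) (h v)]
  induction x using induction_dp generalizing y z with
  | h_dp n v => exact base n v y z
  | h_add a b ha hb => simp only [map_add, LinearMap.add_apply, ha, hb]
  | h_smul c a ha => simp only [map_smul, LinearMap.smul_apply, ha]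
  | h_mul a n v ha =>
    rw [pairL_mul, pairL_mul, comul_pairL]
    generalize (Coalgebra.comul (R := k) y) = s
    induction s with
    | zero => simp
    | add s s' hs hs' => simp only [map_add, LinearMap.add_apply, hs, hs']
    | tmul c d =>
      rw [TensorProduct.map_tmul, LinearMap.mul'_apply, pairL_mul]
      generalize (Coalgebra.comul (R := k) z) = t
      induction t with
      | zero => simp
      | add s s' hs hs' => simp only [map_add, hs, hs']
      | tmul p q =>
        simp only [TensorProduct.map_tmul, LinearMap.mul'_apply, TensorProduct.map₂_apply_tmul,
          ha, base]

end

end DividedPowerAlgebra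

noncomputable section

open CategoryTheory CategoryTheory.Limits

/-- The `k`-linear category `Γ^d_k C` of a `k`-linear category `C`: it has the objects of `C`, and
the module of morphisms from `a` to `b` is `Γ^d_k (C(a, b))`. -/
structure DividedPowerCat (k : Type w) (d : ℕ) (C : Type u) where
  /-- The underlying object of `C`. -/
  as : C

namespace DividedPowerCat

open DividedPowerAlgebra

variable (k : Type w) [CommRing k] (d : ℕ) (C : Type u) [Category.{v} C] [Preadditive C]
  [Linear k C]

/-- The composition is induced by that of `C`: it is the composite
`Γ^d(C(a, b)) ⊗ Γ^d(C(b, c)) → Γ^d(C(a, b) ⊗ C(b, c)) → Γ^d(C(a, c))`. The identity is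
`(𝟙 a)^[d]`. -/
instance : Category (DividedPowerCat k d C) where
  Hom a b := homogeneous k (a.as ⟶ b.as) d
  id a := ⟨dp k d (𝟙 a.as), dp_mem_homogeneous d _⟩
  comp {a b c} x y := ⟨pairL (Linear.comp a.as b.as c.as) x.1 y.1, pairL_mem _ x.2 y.1⟩
  id_comp {a b} x := Subtype.ext
    (pairL_left_unit _ (𝟙 a.as) (fun f => Category.id_comp f) x.2)
  comp_id {a b} x := Subtype.ext <| by
    refine (pairL_right _ (𝟙 b.as) (fun f => Category.comp_id f) d x.1).trans ?_
    rw [proj_of_mem x.2, if_pos rfl]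
  assoc x y z := Subtype.ext
    (pairL_assoc _ _ _ _ (fun f g h => Category.assoc f g h) x.1 y.1 z.1)

instance : Preadditive (DividedPowerCat k d C) where
  homGroup a b := inferInstanceAs (AddCommGroup (homogeneous k (a.as ⟶ b.as) d))
  add_comp a b c x x' y := Subtype.ext (LinearMap.map_add₂ _ x.1 x'.1 y.1)
  comp_add a b c x y y' := Subtype.ext (map_add _ y.1 y'.1)

instance : Linear k (DividedPowerCat k d C) where
  homModule a b := inferInstanceAs (Module k (homogeneous k (a.as ⟶ b.as) d))
  smul_comp a b c r x y := Subtype.ext (LinearMap.map_smul₂ _ r x.1 y.1)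
  comp_smul a b c x r y := Subtype.ext (map_smul _ r y.1)

end DividedPowerCat

section LinearFunctors

variable (k : Type w) [CommRing k] (C : Type u) [Category.{v} C] [Preadditive C] [Linear k C]
  (E : Type u') [Category.{v'} E] [Abelian E] [Linear k E]

/-- The property of being a `k`-linear functor. -/
def isLinearFunctor : ObjectProperty (C ⥤ E) := fun F => F.Additive ∧ F.Linear k

instance : (isLinearFunctor k C E).IsClosedUnderSubobjects where
  prop_of_mono {F G} i _ hG := by
    obtain ⟨_, _⟩ := hG
    refine ⟨⟨fun {a b f g} => ?_⟩, ⟨fun {a b} f r => ?_⟩⟩ <;>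
    · rw [← cancel_mono (i.app b)]
      simp

instance : (isLinearFunctor k C E).IsClosedUnderQuotients where
  prop_of_epi {F G} p _ hF := by
    obtain ⟨_, _⟩ := hF
    refine ⟨⟨fun {a b f g} => ?_⟩, ⟨fun {a b} f r => ?_⟩⟩ <;>
    · rw [← cancel_epi (p.app a)]
      simp only [← p.naturality, Preadditive.comp_add, Functor.map_add, Preadditive.add_comp,
        Functor.map_smul, Linear.comp_smul, Linear.smul_comp]

open ZeroObject in
instance : (isLinearFunctor k C E).ContainsZero where
  exists_zero := ⟨(Functor.const C).obj (0 : E), by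
    rw [IsZero.iff_id_eq_zero]
    ext
    exact (isZero_zero E).eq_of_src _ _,
    ⟨fun {a b f g} => (isZero_zero E).eq_of_src _ _⟩,
    ⟨fun {a b} f r => (isZero_zero E).eq_of_src _ _⟩⟩

instance : (isLinearFunctor k C E).IsClosedUnderFiniteProducts where
  isClosedUnderLimitsOfShape J _ := ⟨by
    rintro F ⟨h⟩
    have hl : ∀ b : C, IsLimit (((evaluation C E).obj b).mapCone h.cone) :=
      fun b => isLimitOfPreserves _ h.isLimit
    have hF := h.prop_diag_obj
    refine ⟨⟨fun {a b f g} => (hl b).hom_ext fun j => ?_⟩,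
      ⟨fun {a b} f r => (hl b).hom_ext fun j => ?_⟩⟩ <;>
    · obtain ⟨_, _⟩ := hF j
      have n := (h.π.app j).naturality
      simp at n ⊢⟩

/-- The category of `k`-linear functors from `C` to `E`, a full subcategory of all functors. -/
abbrev LinearFunctorCat := (isLinearFunctor k C E).FullSubcategory

instance : Abelian (LinearFunctorCat k C E) := inferInstance

end LinearFunctors

/-- The category `P(A)` of finitely generated projective right `A`-modules. -/
abbrev FGProjRight (A : Type u) [Ring A] : Type (u + 1) :=
  ObjectProperty.FullSubcategory (C := ModuleCat.{u} Aᵐᵒᵖ)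
    fun M => Module.Finite Aᵐᵒᵖ M ∧ Module.Projective Aᵐᵒᵖ M

open scoped ModuleCat.Algebra in
/-- The `k`-linear structure of `P(A)` for a `k`-algebra `A`. -/
instance (k : Type u) [CommRing k] (A : Type u) [Ring A] [Algebra k A] :
    Linear k (FGProjRight A) := inferInstance

/-- The category `P_{d;k}(C, E)` of homogeneous strict polynomial functors of degree `d` over `k`
from `C` to `E`: the `k`-linear functors from `Γ^d_k C` to `E`. -/
abbrev StrictPolynomialFunctor (k : Type w) [CommRing k] (d : ℕ)
    (C : Type u) [Category.{v} C] [Preadditive C] [Linear k C]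
    (E : Type u') [Category.{v'} E] [Abelian E] [Linear k E] :=
  LinearFunctorCat k (DividedPowerCat k d C) E

/-- An abelian category is locally noetherian if it is generated by a set of noetherian objects:
there is a small family of noetherian objects `G i` such that two morphisms `f g : X ⟶ Y` are equal
as soon as `h ≫ f = h ≫ g` for all `i` and all `h : G i ⟶ X`. -/
def IsLocallyNoetherian (E : Type u) [Category.{v} E] [Abelian E] : Prop :=
  ∃ (ι : Type w) (G : ι → E), (∀ i, IsNoetherianObject (G i)) ∧
    (ObjectProperty.ofObj G).IsSeparating

end

/-! Put `b = L^d`. The identity of a summand `M` of `L^r` is a sum of `r` endomorphisms `f_i`, one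
for each coordinate, and in `Γ^d` it expands as a sum of monomials `∏ f_i^[n_i]`. Such a monomial of
degree `d` involves at most `d` coordinates, so it factors through `b` (`id_mem_span_comp`). Hence
the functor `Γ^d Hom(b, -)` generates, and a subfunctor of it is controlled by its value at `b`, a
submodule of `Γ^d(V)` with `V = End(b)` which is stable under `Γ^d(A)`
(`stableSubmodule_strictMono`). As `V` is a finitely generated `A`-module, it suffices that `Γ^d(V)`
is noetherian over `Γ^d(A)` (`wellFoundedGT_stableSubmodule`).

Suppose first that `A` is generated by a finite set `σ`. Only the operators `x^[i] 1^[j]` with `x ∈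
σ` and `i + j = d` are needed. They commute (`raise_comm`), so they generate a commutative
`k`-algebra of finite type, which is noetherian; what remains is that finitely many monomials
generate `Γ^d(V)` under them. The elements `x` are treated one at a time
(`exists_finite_monomialSpan_le`). Give `(x^a v)^[n]` the level `a` and the energy `n a^2`. A
monomial of degree `d` has at most `d` nontrivial factors, so some level `l ≤ d` does not occur. If
a level exceeds `d`, lower by one all levels above `l` and apply `x^[i] 1^[j]`, with `i` the total
exponent of the lowered factors. One term of the result is the original monomial. In the other
terms, units of level below `l` are raised instead of units of level at least `l`, so by convexity
of `a^2` the energy is smaller (`raise_levelMonomial_sub_mem`). Induction on the energy reduces to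
levels at most `d`.

In general `A` is a localization. The elements `t^[d]`, with `t` a unit of `A` lying in `k[σ]`,
clear denominators in `Γ^d(V)` (`exists_isUnit_map_smul_mem`), so stable submodules are
distinguished by their traces on the part generated without denominators. -/

namespace DividedPowerAlgebra

noncomputable section

open TensorProduct
open Finset.HasAntidiagonal (antidiagonal mem_antidiagonal)

variable {k : Type*} [CommRing k] {V W U : Type*} [AddCommGroup V] [Module k V]
  [AddCommGroup W] [Module k W] [AddCommGroup U] [Module k U]

/-! ### Complements on the pairing -/

/-- The pairing with `e^[n]` on the right is induced by `β(-, e)`. -/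
lemma pairL_dp_right (β : V →ₗ[k] W →ₗ[k] U) (n : ℕ) (e : W) (x : DividedPowerAlgebra k V) :
    pairL β x (dp k n e) = map k (β.flip e) (proj k V n x) := by
  have base : ∀ (n m : ℕ) (v : V),
      pairL β (dp k m v) (dp k n e) = map k (β.flip e) (proj k V n (dp k m v)) := by
    intro n m v
    rw [pairL_dp, proj_dp, proj_dp]
    by_cases h : n = m
    · subst h; simp
    · rw [if_neg h, if_neg (Ne.symm h), map_zero, map_zero]
  induction x using induction_dp generalizing n with
  | h_dp m v => exact base n m v
  | h_add a b ha hb => simp only [map_add, LinearMap.add_apply, ha, hb]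
  | h_smul c a ha => simp only [map_smul, LinearMap.smul_apply, ha]
  | h_mul a m v ha =>
    rw [pairL_mul, proj_mul, comul_dp, map_sum, map_sum, map_sum]
    simp only [TensorProduct.map_tmul, LinearMap.mul'_apply, ha, base, map_mul]

/-- Naturality of the pairing in the second variable. -/
lemma pairL_map_right {X : Type*} [AddCommGroup X] [Module k X] (β : V →ₗ[k] X →ₗ[k] U)
    (γ : V →ₗ[k] W →ₗ[k] U) (g : W →ₗ[k] X)
    (h : ∀ v w, β v (g w) = γ v w) (x : DividedPowerAlgebra k V) (y : DividedPowerAlgebra k W) :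
    pairL β x (map k g y) = pairL γ x y := by
  have base : ∀ n v (y : DividedPowerAlgebra k W),
      pairL β (dp k n v) (map k g y) = pairL γ (dp k n v) y := by
    intro n v y
    rw [pairL_dp, pairL_dp, proj_map, show γ v = β v ∘ₗ g from LinearMap.ext fun w => (h v w).symm,
      map_comp]
    rfl
  induction x using induction_dp generalizing y with
  | h_dp n v => exact base n v y
  | h_add a b ha hb => simp only [map_add, LinearMap.add_apply, ha, hb]
  | h_smul c a ha => simp only [map_smul, LinearMap.smul_apply, ha]
  | h_mul a n v ha =>
    rw [pairL_mul, pairL_mul, comul_map]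
    generalize (Coalgebra.comul (R := k) y) = t
    induction t with
    | zero => simp
    | add s s' hs hs' => simp only [map_add, hs, hs']
    | tmul p q =>
      simp only [TensorProduct.map_tmul, LinearMap.mul'_apply, AlgHom.toLinearMap_apply, ha, base]

lemma comul_dp_mul_dp (i j : ℕ) (v w : V) : Coalgebra.comul (R := k) (dp k i v * dp k j w) =
    ∑ a ∈ antidiagonal i, ∑ b ∈ antidiagonal j,
      (dp k a.1 v * dp k b.1 w) ⊗ₜ[k] (dp k a.2 v * dp k b.2 w) := by
  rw [Bialgebra.comul_mul, comul_dp, comul_dp, Finset.sum_mul_sum]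
  simp only [Algebra.TensorProduct.tmul_mul_tmul]

/-! ### Monomials with levels -/

section levels

variable {A : Type*} [CommRing A] [Module A V]

/-- The product of the `(x ^ a v)^[n]` for `(n, a, v)` in a multiset. -/
def levelMonomial (k : Type*) [CommRing k] {V : Type*} [AddCommGroup V] [Module k V]
    {A : Type*} [CommRing A] [Module A V] (x : A) (s : Multiset (ℕ × ℕ × V)) :
    DividedPowerAlgebra k V :=
  (s.map fun p => dp k p.1 (x ^ p.2.1 • p.2.2)).prod

/-- The energy `∑ n a ^ 2` of a multiset of triples `(n, a, v)`. -/
def energy {V : Type*} (s : Multiset (ℕ × ℕ × V)) : ℕ :=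
  (s.map fun p => p.1 * p.2.1 ^ 2).sum

/-- The total degree `∑ n` of a multiset of triples `(n, a, v)`. -/
def levelDegree {V : Type*} (s : Multiset (ℕ × ℕ × V)) : ℕ := (s.map Prod.fst).sum

lemma levelMonomial_add (x : A) (s t : Multiset (ℕ × ℕ × V)) :
    levelMonomial k x (s + t) = levelMonomial k x s * levelMonomial k x t := by
  simp [levelMonomial]

lemma energy_add {V : Type*} (s t : Multiset (ℕ × ℕ × V)) : energy (s + t) = energy s + energy t := by
  simp [energy]

lemma levelDegree_add {V : Type*} (s t : Multiset (ℕ × ℕ × V)) :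
    levelDegree (s + t) = levelDegree s + levelDegree t := by
  simp [levelDegree]

lemma levelMonomial_mem_homogeneous (x : A) (s : Multiset (ℕ × ℕ × V)) :
    levelMonomial k x s ∈ homogeneous k V (levelDegree s) := by
  refine Submodule.subset_span ⟨s.map fun p => (p.1, x ^ p.2.1 • p.2.2), ?_, ?_⟩ <;>
  simp [levelMonomial, levelDegree]

variable (k) in
/-- The span of the monomials of degree `n` and of energy at most `c`. -/
def energySpan (x : A) (S : Set V) (n : ℕ) (c : ℤ) : Submodule k (DividedPowerAlgebra k V) :=
  Submodule.span k {z | ∃ s : Multiset (ℕ × ℕ × V), (∀ p ∈ s, p.2.2 ∈ S) ∧ levelDegree s = n ∧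
    (energy s : ℤ) ≤ c ∧ z = levelMonomial k x s}

lemma energySpan_mono (x : A) (S : Set V) (n : ℕ) {c c' : ℤ} (h : c ≤ c') :
    energySpan k x S n c ≤ energySpan k x S n c' := by
  refine Submodule.span_mono ?_
  rintro _ ⟨s, h1, h2, h3, h4⟩
  exact ⟨s, h1, h2, h3.trans h, h4⟩

lemma mul_mem_energySpan {x : A} {S : Set V} {n n' : ℕ} {c c' : ℤ} {z z' : DividedPowerAlgebra k V}
    (hz : z ∈ energySpan k x S n c) (hz' : z' ∈ energySpan k x S n' c') :
    z * z' ∈ energySpan k x S (n + n') (c + c') := by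
  refine (?_ : energySpan k x S n c * energySpan k x S n' c' ≤ _) (Submodule.mul_mem_mul hz hz')
  rw [energySpan, energySpan, Submodule.span_mul_span, Submodule.span_le]
  rintro _ ⟨_, ⟨s, hs, hn, hc, rfl⟩, _, ⟨t, ht, hn', hc', rfl⟩, rfl⟩
  refine Submodule.subset_span ⟨s + t, ?_, ?_, ?_, ?_⟩
  · intro p hp
    rcases Multiset.mem_add.mp hp with hp | hp
    exacts [hs p hp, ht p hp]
  · rw [levelDegree_add, hn, hn']
  · rw [energy_add]; push_cast; linarith
  · exact (levelMonomial_add ..).symm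

/-- Factors with exponent zero equal `1`. Once they are removed, the degree bounds the number of
factors, which the pigeonhole argument on levels requires. -/
lemma energy_filter_ne_zero [DecidableEq V] (s : Multiset (ℕ × ℕ × V)) :
    energy (s.filter fun p => p.1 ≠ 0) = energy s ∧
    levelDegree (s.filter fun p => p.1 ≠ 0) = levelDegree s ∧
    ∀ x : A, levelMonomial k x (s.filter fun p => p.1 ≠ 0) = levelMonomial k x s := by
  induction s using Multiset.induction_on with
  | empty => simp
  | cons p s ih =>
    by_cases h : p.1 = 0
    · rw [Multiset.filter_cons_of_neg _ (by simpa using h)]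
      simp only [energy, levelDegree, levelMonomial] at ih
      simp [energy, levelDegree, levelMonomial, h, dp_zero, ih]
    · rw [Multiset.filter_cons_of_pos _ (by simpa using h)]
      simp only [energy, levelDegree, levelMonomial] at ih
      simp [energy, levelDegree, levelMonomial, ih]

end levels

/-! ### The operators `x^[i] 1^[j]` -/

variable {A : Type*} [CommRing A] [Algebra k A] [Module A V] [IsScalarTower k A V]

variable (k A V) in
/-- The action of `A` on `V`, as a bilinear map `(v, a) ↦ a v`. -/
def smulR : V →ₗ[k] A →ₗ[k] V := (Algebra.lsmul k k V : A →ₐ[k] Module.End k V).toLinearMap.flip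

@[simp] lemma smulR_apply (v : V) (a : A) : smulR k V A v a = a • v := rfl

variable (k V) in
/-- The action of `x^[i] 1^[j]` on `Γ*(V)`. -/
def raise (x : A) (i j : ℕ) : DividedPowerAlgebra k V →ₗ[k] DividedPowerAlgebra k V :=
  (pairL (smulR k V A)).flip (dp k i x * dp k j 1)

lemma raise_apply (x : A) (i j : ℕ) (z : DividedPowerAlgebra k V) :
    raise k V x i j z = pairL (smulR k V A) z (dp k i x * dp k j 1) := rfl

lemma raise_mul (x : A) (i j : ℕ) (z z' : DividedPowerAlgebra k V) :
    raise k V x i j (z * z') = ∑ a ∈ antidiagonal i, ∑ b ∈ antidiagonal j,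
      raise k V x a.1 b.1 z * raise k V x a.2 b.2 z' := by
  rw [raise_apply, pairL_mul, comul_dp_mul_dp]
  simp only [map_sum, TensorProduct.map_tmul, LinearMap.mul'_apply, raise_apply]

lemma raise_dp (x : A) (i j n : ℕ) (v : V) :
    raise k V x i j (dp k n v) = if i + j = n then dp k i (x • v) * dp k j v else 0 := by
  rw [raise_apply, pairL_dp, proj_of_mem
    (mul_mem_homogeneous (dp_mem_homogeneous i x) (dp_mem_homogeneous j (1 : A)))]
  split_ifs <;> simp

lemma raise_one (x : A) (i j : ℕ) :
    raise k V x i j 1 = if i + j = 0 then 1 else 0 := by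
  rw [← dp_zero (R := k) (m := (0 : V)), raise_dp]
  split_ifs with h
  · obtain ⟨rfl, rfl⟩ : i = 0 ∧ j = 0 := by omega
    simp [dp_zero]
  · rfl

lemma raise_zero_right (x : A) {n : ℕ} {z : DividedPowerAlgebra k V}
    (hz : z ∈ homogeneous k V n) :
    raise k V x n 0 z = map k ((smulR k V A).flip x) z := by
  rw [raise_apply, dp_zero, mul_one, pairL_dp_right, proj_of_mem hz, if_pos rfl]

lemma raise_zero_left (x : A) {n : ℕ} {z : DividedPowerAlgebra k V}
    (hz : z ∈ homogeneous k V n) : raise k V x 0 n z = z := by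
  rw [raise_apply, dp_zero, one_mul, pairL_right _ _ (fun v => one_smul A v), proj_of_mem hz,
    if_pos rfl]

/-- The operator splits each exponent into `i` units raised by one level and `j` units left in
place. Energy is estimated factor by factor: `g p` is a reference energy, and `b` and `c` bound the
excess per raised and per unraised unit. Such affine bounds add up over the factors, whatever the
splitting. -/
lemma raise_levelMonomial_mem (x : A) (S : Set V) (g : ℕ × ℕ × V → ℤ) (b c : ℤ)
    (s : Multiset (ℕ × ℕ × V)) (hS : ∀ p ∈ s, p.2.2 ∈ S)
    (hs : ∀ p ∈ s, ∀ i j : ℕ, i + j = p.1 →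
      (i * (p.2.1 + 1) ^ 2 + j * p.2.1 ^ 2 : ℤ) ≤ g p + i * b + j * c) (i j : ℕ) :
    raise k V x i j (levelMonomial k x s) ∈
      energySpan k x S (i + j) ((s.map g).sum + i * b + j * c) := by
  induction s using Multiset.induction_on generalizing i j with
  | empty =>
    simp only [levelMonomial, Multiset.map_zero, Multiset.prod_zero, raise_one]
    split_ifs with h
    · obtain ⟨rfl, rfl⟩ : i = 0 ∧ j = 0 := by omega
      exact Submodule.subset_span ⟨0, by simp [levelDegree, energy, levelMonomial]⟩
    · exact zero_mem _
  | cons p s ih =>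
    have ih' := ih (fun q hq => hS q (Multiset.mem_cons_of_mem hq))
      (fun q hq => hs q (Multiset.mem_cons_of_mem hq))
    have hp : ∀ i j : ℕ, raise k V x i j (dp k p.1 (x ^ p.2.1 • p.2.2)) ∈
        energySpan k x S (i + j) (g p + i * b + j * c) := by
      intro i j
      rw [raise_dp]
      split_ifs with h
      · refine Submodule.subset_span ⟨{(i, p.2.1 + 1, p.2.2), (j, p.2.1, p.2.2)}, ?_, ?_, ?_, ?_⟩
        · have := hS p (Multiset.mem_cons_self p s)
          simp [this]
        · simp [levelDegree]
        · have := hs p (Multiset.mem_cons_self p s) i j h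
          simpa [energy] using this
        · simp [levelMonomial, pow_succ', mul_smul]
      · exact zero_mem _
    have e : levelMonomial k x (p ::ₘ s) =
        dp k p.1 (x ^ p.2.1 • p.2.2) * levelMonomial k x s := by
      simp [levelMonomial]
    rw [e, raise_mul]
    refine Submodule.sum_mem _ fun a ha => Submodule.sum_mem _ fun a' ha' => ?_
    rw [mem_antidiagonal] at ha ha'
    have := mul_mem_energySpan (hp a.1 a'.1) (ih' a.2 a'.2)
    subst ha ha'
    convert this using 2
    · ring
    · rw [Multiset.map_cons, Multiset.sum_cons]; push_cast; ring

lemma raise_levelMonomial_eq_zero (x : A) (s : Multiset (ℕ × ℕ × V)) (i j : ℕ)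
    (h : i + j ≠ levelDegree s) : raise k V x i j (levelMonomial k x s) = 0 := by
  induction s using Multiset.induction_on generalizing i j with
  | empty =>
    simp only [levelMonomial, Multiset.map_zero, Multiset.prod_zero, raise_one]
    exact if_neg h
  | cons p s ih =>
    have e : levelMonomial k x (p ::ₘ s) =
        dp k p.1 (x ^ p.2.1 • p.2.2) * levelMonomial k x s := by
      simp [levelMonomial]
    rw [e, raise_mul]
    refine Finset.sum_eq_zero fun a ha => Finset.sum_eq_zero fun a' ha' => ?_
    rw [mem_antidiagonal] at ha ha'
    simp only [levelDegree, Multiset.map_cons, Multiset.sum_cons] at h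
    by_cases h1 : a.1 + a'.1 = p.1
    · rw [ih a.2 a'.2 (by rw [levelDegree]; omega), mul_zero]
    · rw [raise_dp, if_neg h1, zero_mul]

/-- If no level of `s` is equal to `l`, the monomial of `s` is obtained by raising the factors of
level `≥ l` of a monomial of smaller energy, up to monomials of smaller energy. -/
lemma raise_levelMonomial_sub_mem (x : A) (S : Set V) (l : ℕ) (t b : Multiset (ℕ × ℕ × V))
    (htS : ∀ p ∈ t, p.2.2 ∈ S) (hbS : ∀ p ∈ b, p.2.2 ∈ S)
    (ht : ∀ p ∈ t, l ≤ p.2.1) (hb : ∀ p ∈ b, p.2.1 < l) :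
    raise k V x (levelDegree t) (levelDegree b) (levelMonomial k x (t + b)) -
      levelMonomial k x (t.map (fun p => (p.1, p.2.1 + 1, p.2.2)) + b) ∈
    energySpan k x S (levelDegree t + levelDegree b)
      (energy (t.map (fun p => (p.1, p.2.1 + 1, p.2.2)) + b) - 1) := by
  -- The reference is `t` entirely raised. A unit left at its level `a ≥ l` saves `(a + 1)^2 - a^2 =
  -- 2a + 1 ≥ 2l + 1`.
  have ht' : ∀ i j : ℕ, raise k V x i j (levelMonomial k x t) ∈ energySpan k x S (i + j)
      (energy (t.map (fun p => (p.1, p.2.1 + 1, p.2.2))) - j * (2 * l + 1)) := by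
    intro i j
    have := raise_levelMonomial_mem (k := k) x S (fun p => p.1 * (p.2.1 + 1) ^ 2) 0
      (-(2 * l + 1)) t htS (fun p hp i j h => by
        have h1 : (l : ℤ) ≤ p.2.1 := by exact_mod_cast ht p hp
        have h2 : (0 : ℤ) ≤ j := by positivity
        rw [← h]
        push_cast
        nlinarith) i j
    convert this using 2
    simp only [energy, Multiset.map_map, Function.comp_def, Nat.cast_multiset_sum]
    push_cast
    ring
  -- The reference is `b` left in place. Raising a unit from its level `a ≤ l - 1` costs `2a + 1 ≤
  -- 2l - 1`.
  have hb' : ∀ i j : ℕ, raise k V x i j (levelMonomial k x b) ∈ energySpan k x S (i + j)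
      (energy b + i * (2 * l - 1)) := by
    intro i j
    have := raise_levelMonomial_mem (k := k) x S (fun p => p.1 * p.2.1 ^ 2)
      (2 * l - 1) 0 b hbS (fun p hp i j h => by
        have h1 : (p.2.1 : ℤ) + 1 ≤ l := by exact_mod_cast hb p hp
        have h2 : (0 : ℤ) ≤ i := by positivity
        rw [← h]
        push_cast
        nlinarith) i j
    convert this using 2
    simp only [energy, Multiset.map_map, Function.comp_def, Nat.cast_multiset_sum]
    push_cast
    ring
  -- The extreme term, in which `t` is entirely raised and `b` is untouched, is the monomial to be
  -- reached.
  have hmain : raise k V x (levelDegree t) 0 (levelMonomial k x t) *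
      raise k V x 0 (levelDegree b) (levelMonomial k x b) =
      levelMonomial k x (t.map (fun p => (p.1, p.2.1 + 1, p.2.2)) + b) := by
    rw [raise_zero_right x (levelMonomial_mem_homogeneous x t),
      raise_zero_left x (levelMonomial_mem_homogeneous x b), levelMonomial_add]
    congr 1
    simp only [levelMonomial, map_multiset_prod, Multiset.map_map, Function.comp_def,
      map_apply_dp, LinearMap.flip_apply, smulR_apply, pow_succ', mul_smul]
  rw [levelMonomial_add (s := t), raise_mul, ← Finset.sum_product', ← hmain,
    ← Finset.add_sum_erase _ _ (a := ((levelDegree t, 0), (0, levelDegree b))) (by simp),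
    add_sub_cancel_left]
  refine Submodule.sum_mem _ ?_
  rintro ⟨⟨a1, a2⟩, ⟨b1, b2⟩⟩ h
  simp only [Finset.mem_erase, ne_eq, Prod.mk.injEq, Finset.mem_product, mem_antidiagonal] at h
  obtain ⟨h0, h1, h2⟩ := h
  by_cases h3 : a1 + b1 = levelDegree t
  -- In any other term of the right degrees, `a2 ≥ 1` units of `b` are raised in exchange for as
  -- many units of `t` left in place, so the energy drops by at least `(2l + 1) a2 - (2l - 1) a2 = 2
  -- a2`.
  · have e : a2 = b1 := by omega
    subst e
    have h4 : 1 ≤ a2 := by omega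
    have := mul_mem_energySpan (ht' a1 a2) (hb' a2 b2)
    rw [show a1 + a2 + (a2 + b2) = levelDegree t + levelDegree b by omega] at this
    refine energySpan_mono x S _ ?_ this
    rw [energy_add]
    push_cast
    nlinarith
  · rw [raise_levelMonomial_eq_zero x t a1 b1 h3, zero_mul]
    exact zero_mem _

/-- A submodule which is stable under the operators `x^[i] 1^[j]` of degree `d` and which contains
the monomials of degree `d` with levels at most `d` contains all the monomials of degree `d`. -/
lemma levelMonomial_mem_of_stable (x : A) (S : Set V) (d : ℕ)
    (N : Submodule k (DividedPowerAlgebra k V))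
    (hN : ∀ i j, i + j = d → ∀ z ∈ N, raise k V x i j z ∈ N)
    (h0 : ∀ s : Multiset (ℕ × ℕ × V), (∀ p ∈ s, p.2.1 ≤ d ∧ p.2.2 ∈ S) → levelDegree s = d →
      levelMonomial k x s ∈ N)
    (s : Multiset (ℕ × ℕ × V)) (hs : ∀ p ∈ s, p.2.2 ∈ S) (hd : levelDegree s = d) :
    levelMonomial k x s ∈ N := by
  classical
  induction hq : energy s using Nat.strong_induction_on generalizing s with
  | _ q ih =>
  obtain ⟨e1, e2, e3⟩ := energy_filter_ne_zero (k := k) (A := A) s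
  rw [← e3]
  set s' := s.filter fun p => p.1 ≠ 0 with hs'
  have hS : ∀ p ∈ s', p.2.2 ∈ S := fun p hp => hs p (Multiset.mem_filter.mp hp).1
  have hpos : ∀ p ∈ s', 1 ≤ p.1 := fun p hp =>
    Nat.one_le_iff_ne_zero.mpr (Multiset.mem_filter.mp hp).2
  clear_value s'
  rw [← e1] at hq
  rw [← e2] at hd
  clear e1 e2 e3 hs' hs s
  by_cases hle : ∀ p ∈ s', p.2.1 ≤ d
  · exact h0 s' (fun p hp => ⟨hle p hp, hS p hp⟩) hd
  push Not at hle
  obtain ⟨p₀, hp₀, hlt⟩ := hle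
  -- Pigeonhole: `s'` has at most `d` factors, since all exponents are positive, so one of the `d +
  -- 1` levels `0, …, d` is free.
  obtain ⟨l, hl, hl'⟩ : ∃ l ∈ Finset.range (d + 1), l ∉ (s'.map fun p => p.2.1).toFinset := by
    by_contra! hcon
    have h1 := Finset.card_le_card (show Finset.range (d + 1) ⊆ _ from hcon)
    have h2 := Multiset.toFinset_card_le (s'.map fun p => p.2.1)
    have h3 : s'.card ≤ levelDegree s' := by
      have := Multiset.card_nsmul_le_sum (s := s'.map Prod.fst) (a := 1) (by
        simpa using fun a b c h => hpos (a, b, c) h)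
      simpa [levelDegree] using this
    simp only [Finset.card_range, Multiset.card_map] at h1 h2
    omega
  simp only [Finset.mem_range, Multiset.mem_toFinset, Multiset.mem_map, not_exists, not_and]
    at hl hl'
  -- The factors above the gap `l` are lowered by one, to levels still at least `l`; as `l` does not
  -- occur, the remaining ones have level less than `l`.
  set t := (s'.filter fun p => l < p.2.1).map (fun p => (p.1, p.2.1 - 1, p.2.2)) with ht
  set b := s'.filter fun p => ¬ l < p.2.1 with hb
  have et : t.map (fun p => (p.1, p.2.1 + 1, p.2.2)) = s'.filter fun p => l < p.2.1 := by
    rw [ht, Multiset.map_map]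
    conv_rhs => rw [← Multiset.map_id (s'.filter fun p => l < p.2.1)]
    refine Multiset.map_congr rfl fun p hp => ?_
    have := (Multiset.mem_filter.mp hp).2
    simp [Nat.sub_add_cancel (show 1 ≤ p.2.1 by omega)]
  have es : t.map (fun p => (p.1, p.2.1 + 1, p.2.2)) + b = s' := by
    rw [et]; exact Multiset.filter_add_not _ _
  have hdeg : levelDegree t + levelDegree b = d := by
    rw [← hd, ← es, levelDegree_add]
    simp [levelDegree]
  have htS : ∀ p ∈ t, p.2.2 ∈ S := by
    intro p hp
    obtain ⟨p', hp', rfl⟩ := Multiset.mem_map.mp hp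
    exact hS p' (Multiset.mem_filter.mp hp').1
  have hbS : ∀ p ∈ b, p.2.2 ∈ S := fun p hp => hS p (Multiset.mem_filter.mp hp).1
  have htl : ∀ p ∈ t, l ≤ p.2.1 := by
    intro p hp
    obtain ⟨p', hp', rfl⟩ := Multiset.mem_map.mp hp
    have := (Multiset.mem_filter.mp hp').2
    simp only
    omega
  have hbl : ∀ p ∈ b, p.2.1 < l := by
    intro p hp
    obtain ⟨h1, h2⟩ := Multiset.mem_filter.mp hp
    have := hl' p h1
    omega
  have key := raise_levelMonomial_sub_mem (k := k) x S l t b htS hbS htl hbl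
  rw [es, hdeg] at key
  -- The drop in energy is strict because the factor `p₀`, of level `> d ≥ l` and of positive
  -- exponent, is among the lowered ones.
  have hlow : levelMonomial k x (t + b) ∈ N := by
    refine ih (energy (t + b)) ?_ (t + b) ?_ ?_ rfl
    · rw [← hq, ← es, energy_add, energy_add]
      refine Nat.add_lt_add_right ?_ _
      have hraise : ∀ u : Multiset (ℕ × ℕ × V), energy (u.map fun p => (p.1, p.2.1 + 1, p.2.2)) =
          (u.map fun p => p.1 * (p.2.1 + 1) ^ 2).sum := fun u => by
        rw [energy, Multiset.map_map]; rfl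
      rw [hraise]
      have hsub : ∀ p ∈ t, p.1 * p.2.1 ^ 2 ≤ p.1 * (p.2.1 + 1) ^ 2 := fun p _ =>
        Nat.mul_le_mul_left _ (Nat.pow_le_pow_left (Nat.le_succ _) 2)
      refine Multiset.sum_lt_sum hsub ⟨(p₀.1, p₀.2.1 - 1, p₀.2.2), ?_, ?_⟩
      · exact Multiset.mem_map.mpr ⟨p₀, Multiset.mem_filter.mpr ⟨hp₀, by omega⟩, rfl⟩
      · exact Nat.mul_lt_mul_of_pos_left
          (Nat.pow_lt_pow_left (Nat.lt_succ_self _) two_ne_zero) (hpos p₀ hp₀)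
    · intro p hp
      rcases Multiset.mem_add.mp hp with hp | hp
      exacts [htS p hp, hbS p hp]
    · rw [levelDegree_add, hdeg]
  have hrest : energySpan k x S d (energy s' - 1) ≤ N := by
    refine Submodule.span_le.mpr ?_
    rintro _ ⟨r, hr, hrd, hre, rfl⟩
    exact ih (energy r) (by omega) r hr hrd rfl
  have := N.sub_mem (hN _ _ hdeg _ hlow) (hrest key)
  rwa [sub_sub_cancel] at this

end

end DividedPowerAlgebra

namespace DividedPowerAlgebra

noncomputable section

open TensorProduct
open scoped Pointwise
open Finset.HasAntidiagonal (antidiagonal mem_antidiagonal)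

variable {k : Type*} [CommRing k] {V : Type*} [AddCommGroup V] [Module k V]

/-! ### Spans of monomials in given vectors -/

variable (k) in
/-- The span of the monomials of degree `d` in the divided powers of the elements of `S`. -/
def monomialSpan (S : Set V) (d : ℕ) : Submodule k (DividedPowerAlgebra k V) :=
  Submodule.span k {z | ∃ s : Multiset (ℕ × V), (∀ p ∈ s, p.2 ∈ S) ∧ (s.map Prod.fst).sum = d ∧
    z = (s.map fun p => dp k p.1 p.2).prod}

lemma monomialSpan_mono {S T : Set V} (h : S ⊆ T) (d : ℕ) :
    monomialSpan k S d ≤ monomialSpan k T d := by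
  refine Submodule.span_mono ?_
  rintro _ ⟨s, h1, h2, h3⟩
  exact ⟨s, fun p hp => h (h1 p hp), h2, h3⟩

lemma mul_mem_monomialSpan {S : Set V} {m n : ℕ} {y z : DividedPowerAlgebra k V}
    (hy : y ∈ monomialSpan k S m) (hz : z ∈ monomialSpan k S n) :
    y * z ∈ monomialSpan k S (m + n) := by
  refine (?_ : monomialSpan k S m * monomialSpan k S n ≤ _) (Submodule.mul_mem_mul hy hz)
  rw [monomialSpan, monomialSpan, Submodule.span_mul_span, Submodule.span_le]
  rintro _ ⟨_, ⟨s, hs, rfl, rfl⟩, _, ⟨t, ht, rfl, rfl⟩, rfl⟩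
  refine Submodule.subset_span ⟨s + t, fun p hp => ?_, by simp, by simp⟩
  rcases Multiset.mem_add.mp hp with hp | hp
  exacts [hs p hp, ht p hp]

lemma one_mem_monomialSpan (S : Set V) : (1 : DividedPowerAlgebra k V) ∈ monomialSpan k S 0 :=
  Submodule.subset_span ⟨0, by simp⟩

/-- The divided power of a linear combination expands by the rules for sums and for scalar
multiples. -/
lemma dp_mem_monomialSpan {S : Set V} {v : V} (hv : v ∈ Submodule.span k S) (n : ℕ) :
    dp k n v ∈ monomialSpan k S n := by
  induction hv using Submodule.span_induction generalizing n with
  | mem v hv => exact Submodule.subset_span ⟨{(n, v)}, by simpa using hv, by simp, by simp⟩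
  | zero =>
    rw [dp_null]
    split_ifs with h
    · exact h ▸ one_mem_monomialSpan S
    · exact zero_mem _
  | add v w _ _ hv hw =>
    rw [dp_add]
    refine Submodule.sum_mem _ fun a ha => ?_
    rw [← mem_antidiagonal.mp ha]
    exact mul_mem_monomialSpan (hv _) (hw _)
  | smul c v _ hv =>
    rw [dp_smul]
    exact Submodule.smul_mem _ _ (hv n)

lemma prod_mem_monomialSpan {S : Set V} (s : Multiset (ℕ × V))
    (hs : ∀ p ∈ s, p.2 ∈ Submodule.span k S) :
    (s.map fun p => dp k p.1 p.2).prod ∈ monomialSpan k S (s.map Prod.fst).sum := by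
  induction s using Multiset.induction_on with
  | empty => simpa using one_mem_monomialSpan S
  | cons p s ih =>
    simp only [Multiset.map_cons, Multiset.prod_cons, Multiset.sum_cons]
    exact mul_mem_monomialSpan (dp_mem_monomialSpan (hs p (Multiset.mem_cons_self _ _)) _)
      (ih fun q hq => hs q (Multiset.mem_cons_of_mem hq))

lemma monomialSpan_span_le (S : Set V) (d : ℕ) :
    monomialSpan k (Submodule.span k S : Set V) d ≤ monomialSpan k S d := by
  refine Submodule.span_le.mpr ?_
  rintro _ ⟨s, hs, rfl, rfl⟩
  exact prod_mem_monomialSpan s hs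

lemma prod_dp_mem_span_singleton (v : V) (s : Multiset (ℕ × V)) (hs : ∀ p ∈ s, p.2 = v) :
    (s.map fun p => dp k p.1 p.2).prod ∈ Submodule.span k {dp k (s.map Prod.fst).sum v} := by
  induction s using Multiset.induction_on with
  | empty => simp [dp_zero, Submodule.mem_span_singleton_self]
  | cons p s ih =>
    obtain ⟨c, hc⟩ := Submodule.mem_span_singleton.mp
      (ih fun q hq => hs q (Multiset.mem_cons_of_mem hq))
    simp only [Multiset.map_cons, Multiset.prod_cons, Multiset.sum_cons]
    rw [← hc, hs p (Multiset.mem_cons_self _ _), mul_smul_comm, dp_mul]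
    exact Submodule.smul_mem _ _ (nsmul_mem (Submodule.mem_span_singleton_self _) _)

/-- Since `v^[m] v^[n]` is a multiple of `v^[m + n]`, all the factors in one vector `v` merge into a
single divided power of bounded degree. Induction on `S` then leaves a finite sum of products of
finitely generated modules. -/
lemma monomialSpan_fg {S : Set V} (hS : S.Finite) (d : ℕ) : (monomialSpan k S d).FG := by
  classical
  induction S, hS using Set.Finite.induction_on generalizing d with
  | empty =>
    refine Submodule.fg_span ((Set.finite_singleton 1).subset ?_)
    rintro _ ⟨s, hs, -, rfl⟩
    rw [Multiset.eq_zero_of_forall_notMem fun p hp => hs p hp]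
    simp
  | @insert v S _ _ ih =>
    have key : monomialSpan k (insert v S) d =
        (antidiagonal d).sup fun a => Submodule.span k {dp k a.1 v} * monomialSpan k S a.2 := by
      refine le_antisymm (Submodule.span_le.mpr ?_) (Finset.sup_le fun a ha => ?_)
      · rintro _ ⟨s, hs, hd, rfl⟩
        obtain ⟨s₁, s₂, h1, h2, rfl⟩ : ∃ s₁ s₂ : Multiset (ℕ × V), (∀ p ∈ s₁, p.2 = v) ∧
            (∀ p ∈ s₂, p.2 ∈ S) ∧ s = s₁ + s₂ := by
          refine ⟨s.filter fun p => p.2 = v, s.filter fun p => ¬ p.2 = v,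
            fun p hp => (Multiset.mem_filter.mp hp).2, fun p hp => ?_,
            (Multiset.filter_add_not _ s).symm⟩
          obtain ⟨h1, h2⟩ := Multiset.mem_filter.mp hp
          exact (hs p h1).resolve_left h2
        rw [Multiset.map_add, Multiset.sum_add] at hd
        have hle := Finset.le_sup (f := fun a => Submodule.span k {dp k a.1 v} *
          monomialSpan k S a.2) (mem_antidiagonal.mpr hd :
            ((s₁.map Prod.fst).sum, (s₂.map Prod.fst).sum) ∈ antidiagonal d)
        rw [Multiset.map_add, Multiset.prod_add]
        exact hle (Submodule.mul_mem_mul (prod_dp_mem_span_singleton v s₁ h1)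
          (prod_mem_monomialSpan s₂ fun p hp => Submodule.subset_span (h2 p hp)))
      · rw [Submodule.mul_le]
        intro y hy z hz
        rw [← mem_antidiagonal.mp ha]
        refine mul_mem_monomialSpan ?_ (monomialSpan_mono (Set.subset_insert v S) _ hz)
        obtain ⟨c, rfl⟩ := Submodule.mem_span_singleton.mp hy
        exact Submodule.smul_mem _ _
          (dp_mem_monomialSpan (Submodule.subset_span (Set.mem_insert v S)) _)
    rw [key]
    exact Submodule.fg_finset_sup _ _ fun a _ => (Submodule.fg_span_singleton _).mul (ih a.2)

/-! ### Finite generation -/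

variable {A : Type*} [CommRing A] [Algebra k A] [Module A V] [IsScalarTower k A V]

/-- A submodule of `Γ*(V)` is stable under `x` in degree `d` if it is stable under the operators
`x^[i] 1^[j]` with `i + j = d`. -/
def RaiseStable (d : ℕ) (x : A) (N : Submodule k (DividedPowerAlgebra k V)) : Prop :=
  ∀ i j, i + j = d → ∀ z ∈ N, raise k V x i j z ∈ N

/-- This is `levelMonomial_mem_of_stable` after a choice of a level for each vector `x ^ a • v`. -/
lemma monomialSpan_le_of_raiseStable (x : A) (S : Set V) (d : ℕ)
    (N : Submodule k (DividedPowerAlgebra k V)) (hN : RaiseStable d x N)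
    (h : monomialSpan k {w | ∃ a ≤ d, ∃ v ∈ S, w = x ^ a • v} d ≤ N) :
    monomialSpan k {w | ∃ a, ∃ v ∈ S, w = x ^ a • v} d ≤ N := by
  refine Submodule.span_le.mpr ?_
  rintro _ ⟨s, hs, hd, rfl⟩
  choose! a v hv he using fun (w : V) (hw : ∃ a, ∃ v ∈ S, w = x ^ a • v) => hw
  have := levelMonomial_mem_of_stable x S d N hN (fun t ht htd => h <| Submodule.subset_span
    ⟨t.map fun p => (p.1, x ^ p.2.1 • p.2.2), ?_, ?_, ?_⟩)
    (s.map fun p => (p.1, a p.2, v p.2)) ?_ ?_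
  · rw [levelMonomial, Multiset.map_map] at this
    rw [Multiset.map_congr rfl fun p hp => congrArg (dp k p.1) (he _ (hs p hp))]
    exact this
  · intro p hp
    obtain ⟨q, hq, rfl⟩ := Multiset.mem_map.mp hp
    exact ⟨q.2.1, (ht q hq).1, q.2.2, (ht q hq).2, rfl⟩
  · rw [← htd, levelDegree, Multiset.map_map]; rfl
  · rw [levelMonomial, Multiset.map_map]; rfl
  · intro p hp
    obtain ⟨q, hq, rfl⟩ := Multiset.mem_map.mp hp
    exact hv _ (hs q hq)
  · rw [← hd, levelDegree, Multiset.map_map]; rfl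

/-- Up to the operators `x^[i] 1^[j]` for `x ∈ σ`, the monomials of degree `d` in the `p g`, with
`p` a product of elements of `σ` and `g ∈ G`, are generated by finitely many of them. -/
lemma exists_finite_monomialSpan_le (d : ℕ) {σ : Set A} (hσ : σ.Finite) {G : Set V}
    (hG : G.Finite) : ∃ G' : Set V, G'.Finite ∧ ∀ N : Submodule k (DividedPowerAlgebra k V),
      (∀ x ∈ σ, RaiseStable d x N) → monomialSpan k G' d ≤ N →
      monomialSpan k ((Submonoid.closure σ : Set A) • G) d ≤ N := by
  induction σ, hσ using Set.Finite.induction_on generalizing G with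
  | empty =>
    refine ⟨G, hG, fun N _ h => ?_⟩
    simpa using h
  | @insert x σ _ _ ih =>
    -- The powers of `x` up to `d` are absorbed into the finite set of generators; the energy
    -- argument for `x`, with the multiples of `G` by products of elements of `σ` as vectors, yields
    -- all higher powers.
    obtain ⟨G', hG', h⟩ := ih (G := Set.image2 (fun a g => x ^ a • g) (Set.Iic d) G)
      ((Set.finite_Iic d).image2 _ hG)
    refine ⟨G', hG', fun N hN hN' => ?_⟩
    have h1 := h N (fun y hy => hN y (Set.mem_insert_of_mem x hy)) hN'
    have h2 := monomialSpan_le_of_raiseStable x ((Submonoid.closure σ : Set A) • G) d N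
      (hN x (Set.mem_insert x σ)) ((monomialSpan_mono ?_ d).trans h1)
    · refine (monomialSpan_mono ?_ d).trans h2
      rintro _ ⟨p, hp, g, hg, rfl⟩
      rw [← Set.singleton_union, Submonoid.closure_union] at hp
      obtain ⟨y, hy, q, hq, rfl⟩ := Submonoid.mem_sup.mp hp
      obtain ⟨a, rfl⟩ := Submonoid.mem_closure_singleton.mp hy
      exact ⟨a, q • g, ⟨q, hq, g, hg, rfl⟩, mul_smul _ _ _⟩
    · rintro _ ⟨a, ha, _, ⟨p, hp, g, hg, rfl⟩, rfl⟩
      exact ⟨p, hp, x ^ a • g, ⟨a, ha, g, hg, rfl⟩, smul_comm _ _ _⟩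

/-! ### The noetherian property -/

/-- The ring `Γ^d(A)` is commutative because `A` is: either product is a sum over `2 × 2` matrices
of natural numbers with prescribed row and column sums, and exchanging the two elements transposes
the matrices. -/
lemma pairL_smulR_comm (x y : A) {i j i' j' : ℕ} (h : i + j = i' + j') :
    pairL (smulR k A A) (dp k i x * dp k j 1) (dp k i' y * dp k j' 1) =
      pairL (smulR k A A) (dp k i' y * dp k j' 1) (dp k i x * dp k j 1) := by
  have key : ∀ (x y : A) (i j i' j' : ℕ), i + j = i' + j' →
      pairL (smulR k A A) (dp k i' y * dp k j' 1) (dp k i x * dp k j 1) =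
      ∑ c ∈ (antidiagonal i ×ˢ antidiagonal j) with c.1.1 + c.2.1 = i',
        dp k c.1.1 (x * y) * dp k c.2.1 y * (dp k c.1.2 x * dp k c.2.2 1) := by
    intro x y i j i' j' h
    rw [← raise_apply, raise_mul, Finset.sum_filter, Finset.sum_product]
    refine Finset.sum_congr rfl fun a ha => Finset.sum_congr rfl fun b hb => ?_
    rw [mem_antidiagonal] at ha hb
    rw [raise_dp, raise_dp]
    by_cases h1 : a.1 + b.1 = i'
    · rw [if_pos h1, if_pos h1, if_pos (by omega), smul_eq_mul, smul_eq_mul, mul_one]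
    · rw [if_neg h1, if_neg h1, zero_mul]
  rw [key x y i j i' j' h, key y x i' j' i j h.symm]
  refine Finset.sum_nbij' (fun c => ((c.1.1, c.2.1), (c.1.2, c.2.2)))
    (fun c => ((c.1.1, c.2.1), (c.1.2, c.2.2))) ?_ ?_ ?_ ?_ ?_
  · rintro ⟨⟨a, b⟩, ⟨c, e⟩⟩ hc
    simp only [Finset.mem_filter, Finset.mem_product, mem_antidiagonal] at hc ⊢
    omega
  · rintro ⟨⟨a, b⟩, ⟨c, e⟩⟩ hc
    simp only [Finset.mem_filter, Finset.mem_product, mem_antidiagonal] at hc ⊢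
    omega
  · intro c _; rfl
  · intro c _; rfl
  · intro c _
    simp only
    rw [mul_comm x y]
    ring

/-- By associativity of the pairing, a composite of two operators is the action of a product
computed in `Γ*(A)`. -/
lemma raise_comm (x y : A) {i j i' j' : ℕ} (h : i + j = i' + j') :
    raise k V x i j * raise k V y i' j' = raise k V y i' j' * raise k V x i j := by
  ext z
  simp only [Module.End.mul_apply, raise_apply]
  have hass : ∀ (v : V) (a b : A),
      smulR k V A (smulR k V A v a) b = smulR k V A v (smulR k A A a b) := by
    intro v a b
    simp [mul_smul]
  rw [pairL_assoc _ _ _ _ hass, pairL_assoc _ _ _ _ hass, pairL_smulR_comm x y h]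

end

end DividedPowerAlgebra

/-- A module over a noetherian ring which is generated by a finitely generated submodule under
finitely many commuting operators satisfies the ascending chain condition for submodules stable
under these operators. -/
lemma Module.End.isNoetherian_span_adjoin {k : Type*} [CommRing k] [IsNoetherianRing k]
    {M : Type*} [AddCommGroup M] [Module k M] {ops : Set (Module.End k M)} (hfin : ops.Finite)
    (hcomm : ∀ a ∈ ops, ∀ b ∈ ops, a * b = b * a) {G : Submodule k M} (hG : G.FG) :
    IsNoetherian (Algebra.adjoin k ops) (Submodule.span (Algebra.adjoin k ops) (G : Set M)) := by
  -- The operator algebra is commutative and of finite type over `k`, so Hilbert's basis theorem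
  -- applies to it, and finitely generated modules over it are noetherian.
  have := Algebra.isMulCommutative_adjoin k hcomm
  let _ : CommRing (Algebra.adjoin k ops) :=
    { (inferInstance : Ring (Algebra.adjoin k ops)) with mul_comm := fun a b => this.is_comm.comm a b }
  have : Algebra.FiniteType k (Algebra.adjoin k ops) :=
    (Subalgebra.fg_iff_finiteType _).mp (Subalgebra.fg_def.mpr ⟨ops, hfin, rfl⟩)
  have : IsNoetherianRing (Algebra.adjoin k ops) := Algebra.FiniteType.isNoetherianRing k _
  refine isNoetherian_of_fg_of_noetherian _ ?_
  obtain ⟨s, rfl⟩ := hG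
  rw [Submodule.span_span_of_tower]
  exact Submodule.fg_span s.finite_toSet

/-! ### Clearing denominators, and `Γ^d(V)` as a noetherian `Γ^d(A)`-module -/

namespace DividedPowerAlgebra

open scoped Pointwise
open Finset.HasAntidiagonal (antidiagonal mem_antidiagonal)

variable {k : Type*} [CommRing k] {V : Type*} [AddCommGroup V] [Module k V]
variable {A : Type*} [CommRing A] [Algebra k A] [Module A V] [IsScalarTower k A V]

lemma map_smul_mem_monomialSpan (T : Subalgebra k A) (G : Set V) (x : A) (hx : x ∈ T)
    (d : ℕ) {z : DividedPowerAlgebra k V}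
    (hz : z ∈ monomialSpan k (Submodule.span T G : Set V) d) :
    map k ((smulR k V A).flip x) z ∈ monomialSpan k (Submodule.span T G : Set V) d := by
  refine (?_ : monomialSpan k (Submodule.span T G : Set V) d ≤
    (monomialSpan k (Submodule.span T G : Set V) d).comap (map k _).toLinearMap) hz
  refine Submodule.span_le.mpr ?_
  rintro _ ⟨s, hs, hd, rfl⟩
  refine Submodule.subset_span ⟨s.map fun p => (p.1, x • p.2), ?_, ?_, ?_⟩
  · intro p hp
    obtain ⟨q, hq, rfl⟩ := Multiset.mem_map.mp hp
    exact Submodule.smul_mem _ (⟨x, hx⟩ : T) (hs q hq)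
  · rw [← hd, Multiset.map_map]; rfl
  · simp only [AlgHom.toLinearMap_apply, map_multiset_prod, Multiset.map_map, Function.comp_def,
      map_apply_dp, LinearMap.flip_apply, smulR_apply]

/-- Denominators can be cleared in `Γ^d(V)`. -/
lemma exists_isUnit_map_smul_mem (T : Subalgebra k A)
    (hT : ∀ a : A, ∃ t ∈ T, IsUnit t ∧ a * t ∈ T) {G : Set V} (hG : Submodule.span A G = ⊤)
    (d : ℕ) {z : DividedPowerAlgebra k V} (hz : z ∈ homogeneous k V d) :
    ∃ t ∈ T, IsUnit t ∧ map k ((smulR k V A).flip t) z ∈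
      monomialSpan k (Submodule.span T G : Set V) d := by
  have hmul : ∀ s t : A, (map k ((smulR k V A).flip (s * t)) : _ →ₐ[k] _) =
      (map k ((smulR k V A).flip s)).comp (map k ((smulR k V A).flip t)) := by
    intro s t
    refine hom_ext fun n v => ?_
    simp [mul_smul]
  -- Denominators are first cleared in `V`, by multiplying those of the terms of a linear
  -- combination.
  have hV : ∀ v : V, ∃ t ∈ T, IsUnit t ∧ t • v ∈ Submodule.span T G := by
    intro v
    have hv : v ∈ Submodule.span A G := hG ▸ Submodule.mem_top
    induction hv using Submodule.span_induction with
    | mem v hv => exact ⟨1, one_mem T, isUnit_one, by simpa using Submodule.subset_span hv⟩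
    | zero => exact ⟨1, one_mem T, isUnit_one, by simp⟩
    | add v w _ _ hv hw =>
      obtain ⟨s, hs, hs', hv⟩ := hv
      obtain ⟨t, ht, ht', hw⟩ := hw
      refine ⟨s * t, mul_mem hs ht, hs'.mul ht', ?_⟩
      rw [smul_add, mul_smul s t w, mul_comm s t, mul_smul t s v]
      exact add_mem (Submodule.smul_mem _ (⟨t, ht⟩ : T) hv)
        (Submodule.smul_mem _ (⟨s, hs⟩ : T) hw)
    | smul a v _ hv =>
      obtain ⟨s, hs, hs', hv⟩ := hv
      obtain ⟨t, ht, ht', ha⟩ := hT a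
      refine ⟨s * t, mul_mem hs ht, hs'.mul ht', ?_⟩
      rw [show (s * t) • a • v = (a * t) • s • v by simp only [smul_smul]; ring_nf]
      exact Submodule.smul_mem _ (⟨a * t, ha⟩ : T) hv
  induction hz using Submodule.span_induction with
  | mem z hz =>
    obtain ⟨s, rfl, rfl⟩ := hz
    induction s using Multiset.induction_on with
    | empty =>
      refine ⟨1, one_mem T, isUnit_one, ?_⟩
      simpa using one_mem_monomialSpan (k := k) _
    | cons p s ih =>
      obtain ⟨t, ht, ht', h⟩ := ih
      obtain ⟨r, hr, hr', hv⟩ := hV p.2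
      -- `Γ(t r)` is an algebra map, so it acts on each factor: `r` clears the new factor, `t`
      -- clears the others, and the superfluous multiplier is harmless because it lies in `T`.
      refine ⟨t * r, mul_mem ht hr, ht'.mul hr', ?_⟩
      simp only [Multiset.map_cons, Multiset.prod_cons, map_mul, Multiset.sum_cons]
      refine mul_mem_monomialSpan ?_ ?_
      · rw [hmul]
        refine map_smul_mem_monomialSpan T G t ht _ ?_
        rw [RingHom.coe_coe, map_apply_dp]
        exact dp_mem_monomialSpan (Submodule.subset_span hv) _
      · rw [mul_comm t r, hmul]
        exact map_smul_mem_monomialSpan T G r hr _ h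
  | zero => exact ⟨1, one_mem T, isUnit_one, by simp⟩
  | add y z _ _ hy hz =>
    obtain ⟨s, hs, hs', hy⟩ := hy
    obtain ⟨t, ht, ht', hz⟩ := hz
    refine ⟨s * t, mul_mem hs ht, hs'.mul ht', ?_⟩
    rw [map_add]
    refine add_mem ?_ ?_
    · rw [mul_comm s t, hmul]
      exact map_smul_mem_monomialSpan T G t ht _ hy
    · rw [hmul]
      exact map_smul_mem_monomialSpan T G s hs _ hz
  | smul a z _ hz =>
    obtain ⟨t, ht, ht', hz⟩ := hz
    refine ⟨t, ht, ht', ?_⟩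
    rw [map_smul]
    exact Submodule.smul_mem _ _ hz

/-- The span over `k[σ]` is the `k`-span of the multiples by products of elements of `σ`. -/
lemma span_adjoin_le_span_closure_smul (σ : Set A) (G : Set V) :
    (Submodule.span (Algebra.adjoin k σ) G : Set V) ⊆
      Submodule.span k ((Submonoid.closure σ : Set A) • G) := by
  intro v hv
  rw [SetLike.mem_coe] at hv ⊢
  induction hv using Submodule.span_induction with
  | mem v hv => exact Submodule.subset_span ⟨1, one_mem _, v, hv, one_smul _ _⟩
  | zero => exact zero_mem _
  | add v w _ _ hv hw => exact add_mem hv hw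
  | smul a v hv' hv =>
    clear hv'
    obtain ⟨a, ha⟩ := a
    change a • v ∈ _
    rw [← Subalgebra.mem_toSubmodule, Algebra.adjoin_eq_span] at ha
    induction ha using Submodule.span_induction with
    | mem p hp =>
      induction hv using Submodule.span_induction with
      | mem w hw =>
        obtain ⟨q, hq, g, hg, rfl⟩ := hw
        exact Submodule.subset_span ⟨p * q, mul_mem hp hq, g, hg, mul_smul _ _ _⟩
      | zero => simp
      | add v w _ _ hv hw => rw [smul_add]; exact add_mem hv hw
      | smul c v _ hv => rw [smul_comm]; exact Submodule.smul_mem _ _ hv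
    | zero => simp
    | add a b _ _ ha hb => rw [add_smul]; exact add_mem ha hb
    | smul c a _ ha => rw [smul_assoc]; exact Submodule.smul_mem _ _ ha

variable (k V A) in
/-- The submodules of `Γ^d(V)` which are stable under the action of `Γ^d(A)`. -/
abbrev StableSubmodule (d : ℕ) := {N : Submodule k (DividedPowerAlgebra k V) //
  N ≤ homogeneous k V d ∧ ∀ y ∈ homogeneous k A d, ∀ z ∈ N, pairL (smulR k V A) z y ∈ N}

/-- If `k` is noetherian, `A` is essentially of finite type over `k` and `V` is a finitely
generated `A`-module, then `Γ^d(V)` is a noetherian module over `Γ^d(A)`. -/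
theorem wellFoundedGT_stableSubmodule [IsNoetherianRing k] [Algebra.EssFiniteType k A]
    [Module.Finite A V] (d : ℕ) : WellFoundedGT (StableSubmodule k V A d) := by
  classical
  obtain ⟨σ, hσ⟩ := (Algebra.essFiniteType_iff k A).mp inferInstance
  obtain ⟨G, hG⟩ := Module.Finite.fg_top (R := A) (M := V)
  obtain ⟨G', hG', hN⟩ := exists_finite_monomialSpan_le (k := k) d σ.finite_toSet G.finite_toSet
  let ops : Set (Module.End k (DividedPowerAlgebra k V)) :=
    Set.image2 (fun x (a : ℕ × ℕ) => raise k V x a.1 a.2) (σ : Set A) (antidiagonal d : Finset (ℕ × ℕ))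
  have hops : ops.Finite := σ.finite_toSet.image2 _ (Finset.finite_toSet _)
  have hcomm : ∀ a ∈ ops, ∀ b ∈ ops, a * b = b * a := by
    rintro _ ⟨x, _, a, ha, rfl⟩ _ ⟨y, _, b, hb, rfl⟩
    refine raise_comm x y ?_
    rw [mem_antidiagonal.mp ha, mem_antidiagonal.mp hb]
  have hnoeth := Module.End.isNoetherian_span_adjoin hops hcomm (monomialSpan_fg (k := k) hG' d)
  set N₀ := Submodule.span (Algebra.adjoin k ops) (monomialSpan k G' d : Set (DividedPowerAlgebra k V))
  have hraise : ∀ x ∈ σ, ∀ i j, i + j = d → raise k V x i j ∈ Algebra.adjoin k ops :=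
    fun x hx i j hij => Algebra.subset_adjoin ⟨x, hx, (i, j), by simpa using hij, rfl⟩
  -- `N₀` contains the part of `Γ^d(V)` without denominators: it contains the finitely many starting
  -- monomials and is stable under the operators.
  have hle : monomialSpan k (Submodule.span (Algebra.adjoin k (σ : Set A)) (G : Set V) : Set V) d ≤
      N₀.restrictScalars k := by
    have h1 := hN (N₀.restrictScalars k) (fun x hx i j hij z hz =>
      N₀.smul_mem (⟨_, hraise x hx i j hij⟩ : Algebra.adjoin k ops) hz) Submodule.subset_span
    refine le_trans ((monomialSpan_mono ?_ d).trans (monomialSpan_span_le _ d)) h1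
    exact span_adjoin_le_span_closure_smul _ _
  -- The trace of `N` on `N₀` is stable under the operators because `x^[i] 1^[j]` belongs to
  -- `Γ^d(A)` for `i + j = d`.
  let φ : StableSubmodule k V A d → Submodule (Algebra.adjoin k ops) N₀ := fun N =>
    { carrier := {m | (m : DividedPowerAlgebra k V) ∈ N.1}
      add_mem' := fun ha hb => N.1.add_mem ha hb
      zero_mem' := N.1.zero_mem
      smul_mem' := by
        rintro ⟨c, hc⟩ m hm
        change c m.1 ∈ N.1
        have : ∀ z ∈ N.1, c z ∈ N.1 := by
          induction hc using Algebra.adjoin_induction with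
          | mem c hc =>
            obtain ⟨x, hx, a, ha, rfl⟩ := hc
            intro z hz
            refine N.2.2 _ ?_ z hz
            rw [← mem_antidiagonal.mp ha]
            exact mul_mem_homogeneous (dp_mem_homogeneous _ _) (dp_mem_homogeneous _ _)
          | algebraMap r =>
            intro z hz
            simpa [Module.algebraMap_end_apply] using N.1.smul_mem r hz
          | add a b _ _ ha hb => exact fun z hz => N.1.add_mem (ha z hz) (hb z hz)
          | mul a b _ _ ha hb => exact fun z hz => ha _ (hb z hz)
        exact this _ hm }
  -- If `N ≤ N'` have the same trace on `N₀` and `z ∈ N'`, then `t^[d]` moves `z` into that trace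
  -- for a suitable unit `t`, and `(t⁻¹)^[d]` brings it back inside `N`.
  have hφ : StrictMono φ := by
    intro N N' hlt
    refine lt_of_le_not_ge (fun m hm => hlt.le hm) fun hge => hlt.not_ge fun z hz => ?_
    obtain ⟨t, htT, ⟨t, rfl⟩, hzt⟩ := exists_isUnit_map_smul_mem (k := k) _ hσ hG d (N'.2.1 hz)
    have hdp : ∀ (a : A) (y : DividedPowerAlgebra k V), y ∈ homogeneous k V d →
        pairL (smulR k V A) y (dp k d a) = map k ((smulR k V A).flip a) y := by
      intro a y hy
      rw [pairL_dp_right, proj_of_mem hy, if_pos rfl]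
    have h1 : map k ((smulR k V A).flip (t : A)) z ∈ N'.1 := by
      rw [← hdp _ _ (N'.2.1 hz)]
      exact N'.2.2 _ (dp_mem_homogeneous _ _) z hz
    have h2 : map k ((smulR k V A).flip (t : A)) z ∈ N.1 :=
      hge (show (⟨_, hle hzt⟩ : N₀) ∈ φ N' from h1)
    have h3 := N.2.2 _ (dp_mem_homogeneous d (↑t⁻¹ : A)) _ h2
    rw [hdp _ _ (N.2.1 h2)] at h3
    have h4 : (map k ((smulR k V A).flip (↑t⁻¹ : A))).comp (map k ((smulR k V A).flip (t : A))) =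
        AlgHom.id k (DividedPowerAlgebra k V) := by
      refine hom_ext fun n v => ?_
      simp [smul_smul]
    have h5 := DFunLike.congr_fun h4 z
    rw [AlgHom.comp_apply, AlgHom.id_apply] at h5
    rwa [h5] at h3
  exact hφ.wellFoundedGT

end DividedPowerAlgebra

noncomputable section

open CategoryTheory CategoryTheory.Limits Opposite DividedPowerAlgebra

/-! ### Generation of the category of strict polynomial functors -/

/-- An object `b` is a `d`-fold generator if the identity of each object is a finite sum of
endomorphisms any `d` of which factor through a common morphism to `b`. -/
def IsFoldGenerator {C : Type*} [Category C] [Preadditive C] (d : ℕ) (b : C) : Prop :=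
  ∀ M : C, ∃ (r : ℕ) (f : Fin r → (M ⟶ M)), ∑ i, f i = 𝟙 M ∧
    ∀ τ : Fin d → Fin r, ∃ p : M ⟶ b, ∀ c, ∃ h : b ⟶ M, p ≫ h = f (τ c)

namespace DividedPowerCat

variable {k : Type*} [CommRing k] {d : ℕ} {C : Type*} [Category C] [Preadditive C] [Linear k C]

/-- In `Γ^d_k C`, the identities are sums of morphisms which factor through a `d`-fold generator
of `C`. -/
lemma id_mem_span_comp {b : C} (hb : IsFoldGenerator d b) (M : DividedPowerCat k d C) :
    𝟙 M ∈ Submodule.span k {y : M ⟶ M | ∃ (p : M ⟶ ⟨b⟩) (q : (⟨b⟩ : DividedPowerCat k d C) ⟶ M),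
      y = p ≫ q} := by
  obtain ⟨r, f, hf, hτ⟩ := hb M.as
  have hfac : ∀ s ∈ (Finset.univ : Finset (Fin r)).sym d,
      ∃ y ∈ {y : M ⟶ M | ∃ (p : M ⟶ ⟨b⟩) (q : (⟨b⟩ : DividedPowerCat k d C) ⟶ M),
        y = p ≫ q}, y.1 = ∏ i, dp k (Multiset.count i (s : Multiset (Fin r))) (f i) := by
    intro s _
    -- A monomial of degree `d` is indexed by a multiset of `d` indices; `τ` enumerates it.
    obtain ⟨τ, hs⟩ : ∃ τ : Fin d → Fin r, ∀ i ∈ (s : Multiset (Fin r)), ∃ c, τ c = i := by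
      obtain ⟨s, hs⟩ := s
      induction s using Quotient.inductionOn with
      | _ l =>
        have hl : l.length = d := hs
        subst hl
        refine ⟨l.get, fun i hi => ?_⟩
        exact List.mem_iff_get.mp hi
    obtain ⟨p, hp⟩ := hτ τ
    -- Outside `s` the value `0` is arbitrary: there the exponent is zero and the divided power is
    -- `1`.
    have hg : ∀ i, ∃ g : b ⟶ M.as, i ∈ (s : Multiset (Fin r)) → p ≫ g = f i := by
      intro i
      by_cases hi : i ∈ (s : Multiset (Fin r))
      · obtain ⟨c, rfl⟩ := hs i hi
        exact ⟨_, fun _ => (hp c).choose_spec⟩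
      · exact ⟨0, fun h => absurd h hi⟩
    choose g hg using hg
    have hY : ∏ i, dp k (Multiset.count i (s : Multiset (Fin r))) (g i) ∈
        homogeneous k (b ⟶ M.as) d := by
      refine Submodule.subset_span ⟨(Finset.univ : Finset (Fin r)).val.map fun i =>
        (Multiset.count i (s : Multiset (Fin r)), g i), ?_, ?_⟩
      · rw [Multiset.map_map]
        exact (Multiset.sum_count_eq_card (s := Finset.univ) (fun a _ => Finset.mem_univ a)).trans
          s.2
      · rw [Multiset.map_map]
        rfl
    refine ⟨(show M ⟶ ⟨b⟩ from ⟨dp k d p, dp_mem_homogeneous d p⟩) ≫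
      (show (⟨b⟩ : DividedPowerCat k d C) ⟶ M from ⟨_, hY⟩), ⟨_, _, rfl⟩, ?_⟩
    -- Composition with `p^[d]` is `Γ(p ≫ -)`, an algebra map, so it turns the monomial in the `g i`
    -- into the one in the `f i`.
    change pairL (Linear.comp M.as b M.as) (dp k d p) _ = _
    rw [pairL_dp, proj_of_mem hY, if_pos rfl, map_prod]
    refine Finset.prod_congr rfl fun i _ => ?_
    rw [map_apply_dp]
    by_cases hi : i ∈ (s : Multiset (Fin r))
    · congr 1
      exact hg i hi
    · rw [Multiset.count_eq_zero_of_notMem hi, dp_zero, dp_zero]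
  choose! y hy hy' using hfac
  -- This is the expansion of `(∑ f_i)^[d]`, the identity of `M` in `Γ^d_k C`.
  have : 𝟙 M = ∑ s ∈ (Finset.univ : Finset (Fin r)).sym d, y s := by
    refine Subtype.ext ?_
    have e : (∑ s ∈ (Finset.univ : Finset (Fin r)).sym d, y s).1 =
        ∑ s ∈ (Finset.univ : Finset (Fin r)).sym d, (y s).1 :=
      map_sum (homogeneous k (M.as ⟶ M.as) d).subtype y _
    rw [e, Finset.sum_congr rfl hy', ← dp_sum, hf]
    rfl
  rw [this]
  exact Submodule.sum_mem _ fun s hs => Submodule.subset_span (hy s hs)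

end DividedPowerCat

/-! ### The representable functor of a `d`-fold generator -/

namespace StrictPolynomialFunctor

variable {k : Type u} [CommRing k] {d : ℕ} {C : Type u'} [Category.{u} C] [Preadditive C]
  [Linear k C]

instance (F : StrictPolynomialFunctor k d C (ModuleCat.{u} k)) : F.obj.Additive := F.property.1

instance (F : StrictPolynomialFunctor k d C (ModuleCat.{u} k)) : F.obj.Linear k := F.property.2

/-- An additive property of the elements of `F(M)` holds as soon as it holds for the elements which
come from the value of `F` at a `d`-fold generator. -/
lemma mem_of_forall_map_mem {b : C} (hb : IsFoldGenerator d b)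
    (F : StrictPolynomialFunctor k d C (ModuleCat.{u} k)) (M : DividedPowerCat k d C)
    (N : Submodule k (F.obj.obj M)) (x : F.obj.obj M)
    (h : ∀ (p : M ⟶ ⟨b⟩) (q : (⟨b⟩ : DividedPowerCat k d C) ⟶ M),
      F.obj.map q (F.obj.map p x) ∈ N) : x ∈ N := by
  have key : ∀ y ∈ Submodule.span k {y : M ⟶ M | ∃ (p : M ⟶ ⟨b⟩)
      (q : (⟨b⟩ : DividedPowerCat k d C) ⟶ M), y = p ≫ q}, F.obj.map y x ∈ N := by
    intro y hy
    induction hy using Submodule.span_induction with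
    | mem y hy =>
      obtain ⟨p, q, rfl⟩ := hy
      simpa using h p q
    | zero => simp
    | add y z _ _ hy hz =>
      rw [Functor.map_add]
      exact N.add_mem hy hz
    | smul a y _ hy =>
      rw [Functor.map_smul]
      exact N.smul_mem a hy
  simpa using key _ (DividedPowerCat.id_mem_span_comp hb M)

variable (k d) in
/-- The representable strict polynomial functor `Γ^d Hom(b, -)`. -/
def representable (b : C) : StrictPolynomialFunctor k d C (ModuleCat.{u} k) where
  obj := (linearCoyoneda k (DividedPowerCat k d C)).obj (op ⟨b⟩)
  property := ⟨inferInstance, ⟨fun {X Y} f r => by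
    ext y
    exact Linear.comp_smul _ _ _ y r f⟩⟩

/-- The morphism from a representable functor which corresponds to an element. -/
def ofElement {b : C} (F : StrictPolynomialFunctor k d C (ModuleCat.{u} k))
    (x : F.obj.obj ⟨b⟩) : representable k d b ⟶ F :=
  ObjectProperty.homMk
  { app := fun M => ModuleCat.ofHom
      { toFun := fun y => F.obj.map y x
        map_add' := fun y z => by rw [Functor.map_add]; rfl
        map_smul' := fun r y => by rw [Functor.map_smul]; rfl }
    naturality := fun M N g => by
      ext y
      exact ConcreteCategory.congr_hom (F.obj.map_comp y g) x }

lemma ofElement_comp_app_id {b : C} {F G : StrictPolynomialFunctor k d C (ModuleCat.{u} k)}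
    (x : F.obj.obj ⟨b⟩) (f : F ⟶ G) :
    (ofElement F x ≫ f).hom.app ⟨b⟩ (𝟙 (⟨b⟩ : DividedPowerCat k d C)) = f.hom.app ⟨b⟩ x := by
  change f.hom.app ⟨b⟩ (F.obj.map (𝟙 _) x) = _
  simp

/-- By Yoneda, morphisms from the representable functor detect the values at `b`; two morphisms of
functors which agree at `b` agree everywhere, since identities are sums of maps through `b`. -/
lemma isSeparating_representable {b : C} (hb : IsFoldGenerator d b) :
    (ObjectProperty.ofObj fun _ : PUnit.{w + 1} => representable k d b).IsSeparating := by
  intro F G f g h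
  have hb' : ∀ x, f.hom.app ⟨b⟩ x = g.hom.app ⟨b⟩ x := by
    intro x
    rw [← ofElement_comp_app_id, ← ofElement_comp_app_id,
      h _ (ObjectProperty.ofObj_apply _ PUnit.unit) (ofElement F x)]
  ext M x
  refine mem_of_forall_map_mem hb F M (LinearMap.eqLocus (f.hom.app M).hom (g.hom.app M).hom) x
    fun p q => ?_
  rw [LinearMap.mem_eqLocus]
  have h1 := ConcreteCategory.congr_hom (f.hom.naturality q) (F.obj.map p x)
  have h2 := ConcreteCategory.congr_hom (g.hom.naturality q) (F.obj.map p x)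
  exact h1.trans ((congrArg (G.obj.map q) (hb' _)).trans h2.symm)

/-- Elements of `F(b)` are morphisms from the representable functor to `F`, and a monomorphism can
be cancelled from these. -/
lemma app_injective_of_mono {b : C} {F G : StrictPolynomialFunctor k d C (ModuleCat.{u} k)}
    (f : F ⟶ G) [Mono f] : Function.Injective (f.hom.app ⟨b⟩) := by
  intro x y hxy
  have : ofElement F x = ofElement F y := by
    rw [← cancel_mono f]
    ext M z
    change f.hom.app M (F.obj.map z x) = f.hom.app M (F.obj.map z y)
    have h1 := ConcreteCategory.congr_hom (f.hom.naturality z) x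
    have h2 := ConcreteCategory.congr_hom (f.hom.naturality z) y
    exact h1.trans ((congrArg (G.obj.map z) hxy).trans h2.symm)
  have h1 := ofElement_comp_app_id x (𝟙 F)
  have h2 := ofElement_comp_app_id y (𝟙 F)
  rw [this] at h1
  exact h1.symm.trans h2

/-- Surjectivity propagates from `b` to every object: the image of `f` at `M` contains whatever
comes from `G(b)`, hence all of `G(M)`. -/
lemma epi_of_app_surjective {b : C} (hb : IsFoldGenerator d b)
    {F G : StrictPolynomialFunctor k d C (ModuleCat.{u} k)} (f : F ⟶ G)
    (hf : Function.Surjective (f.hom.app ⟨b⟩)) : Epi f := by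
  have hs : ∀ (M : DividedPowerCat k d C) (x : G.obj.obj M),
      x ∈ LinearMap.range (f.hom.app M).hom := by
    intro M x
    refine mem_of_forall_map_mem hb G M _ x fun p q => ?_
    obtain ⟨y, hy⟩ := hf (G.obj.map p x)
    refine ⟨F.obj.map q y, ?_⟩
    exact (ConcreteCategory.congr_hom (f.hom.naturality q) y).trans (congrArg (G.obj.map q) hy)
  refine ⟨fun {H} g h hgh => ?_⟩
  ext M x
  obtain ⟨y, rfl⟩ := hs M x
  exact ConcreteCategory.congr_hom (congr_app (congrArg (fun t => t.hom) hgh) M) y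

/-! ### From subfunctors of the representable functor to stable submodules -/

variable {A : Type v} [CommRing A] [Algebra k A] [Linear A C]

lemma coe_app_map {b : C} {F : StrictPolynomialFunctor k d C (ModuleCat.{u} k)}
    (f : F ⟶ representable k d b) (w : (⟨b⟩ : DividedPowerCat k d C) ⟶ ⟨b⟩) (z : F.obj.obj ⟨b⟩) :
    (f.hom.app ⟨b⟩ (F.obj.map w z) : homogeneous k (b ⟶ b) d).1 =
      pairL (Linear.comp b b b) (f.hom.app ⟨b⟩ z : homogeneous k (b ⟶ b) d).1 w.1 :=
  congrArg Subtype.val (ConcreteCategory.congr_hom (f.hom.naturality w) z)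

/-- The module of the values at `b` of a morphism to the representable functor of `b`. -/
def valueSubmodule {b : C} {F : StrictPolynomialFunctor k d C (ModuleCat.{u} k)}
    (f : F ⟶ representable k d b) : Submodule k (DividedPowerAlgebra k (b ⟶ b)) :=
  LinearMap.range ((homogeneous k (b ⟶ b) d).subtype ∘ₗ
    ((f.hom.app ⟨b⟩).hom : F.obj.obj ⟨b⟩ →ₗ[k] homogeneous k (b ⟶ b) d))

lemma mem_valueSubmodule {b : C} {F : StrictPolynomialFunctor k d C (ModuleCat.{u} k)}
    (f : F ⟶ representable k d b) {x : DividedPowerAlgebra k (b ⟶ b)} :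
    x ∈ valueSubmodule f ↔
      ∃ z, (f.hom.app ⟨b⟩ z : homogeneous k (b ⟶ b) d).1 = x := Iff.rfl

/-- An element `a` of `A` acts as composition with the endomorphism `a • 𝟙 b`. Thus `Γ^d(A)` acts
through endomorphisms of `b` in `Γ^d_k C`, and the image of a natural transformation is stable under
these. -/
lemma pairL_mem_valueSubmodule {b : C} [IsScalarTower k A (b ⟶ b)]
    {F : StrictPolynomialFunctor k d C (ModuleCat.{u} k)} (f : F ⟶ representable k d b)
    {y : DividedPowerAlgebra k A} (hy : y ∈ homogeneous k A d)
    {x : DividedPowerAlgebra k (b ⟶ b)} (hx : x ∈ valueSubmodule f) :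
    pairL (smulR k (b ⟶ b) A) x y ∈ valueSubmodule f := by
  obtain ⟨z, rfl⟩ := (mem_valueSubmodule f).mp hx
  let ρ : A →ₗ[k] (b ⟶ b) := (LinearMap.toSpanSingleton A (b ⟶ b) (𝟙 b)).restrictScalars k
  have hρ : map k ρ y ∈ homogeneous k (b ⟶ b) d := by
    have := proj_mem d (map k ρ y)
    rwa [proj_map, proj_of_mem hy, if_pos rfl] at this
  refine (mem_valueSubmodule f).mpr
    ⟨F.obj.map (show (⟨b⟩ : DividedPowerCat k d C) ⟶ ⟨b⟩ from ⟨map k ρ y, hρ⟩) z, ?_⟩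
  rw [coe_app_map]
  refine pairL_map_right _ _ ρ (fun v a => ?_) _ y
  change v ≫ (a • 𝟙 b) = a • v
  rw [Linear.comp_smul, Category.comp_id]

variable (k d A) in
/-- The value at `b` of a subfunctor of the representable functor of `b`. -/
def stableSubmodule (b : C) [IsScalarTower k A (b ⟶ b)]
    (S : Subobject (representable k d b)) : StableSubmodule k (b ⟶ b) A d :=
  ⟨valueSubmodule S.arrow, by
    rintro _ ⟨z, rfl⟩
    exact Subtype.prop _, fun _ hy _ hx => pairL_mem_valueSubmodule S.arrow hy hx⟩

/-- If `S ≤ T` have the same value at `b`, the inclusion is surjective at `b`, hence an epimorphism;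
being also a monomorphism in an abelian category, it is invertible. -/
lemma stableSubmodule_strictMono {b : C} (hb : IsFoldGenerator d b) [IsScalarTower k A (b ⟶ b)] :
    StrictMono (stableSubmodule k d A b) := by
  intro S T hlt
  have hle := hlt.le
  have harrow : ∀ z, T.arrow.hom.app ⟨b⟩ ((Subobject.ofLE S T hle).hom.app ⟨b⟩ z) =
      S.arrow.hom.app ⟨b⟩ z := fun z =>
    ConcreteCategory.congr_hom (congr_app (congrArg (fun t => t.hom)
      (Subobject.ofLE_arrow hle)) ⟨b⟩) z
  refine lt_of_le_not_ge ?_ fun hge => hlt.not_ge ?_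
  · rintro _ ⟨z, rfl⟩
    exact (mem_valueSubmodule T.arrow).mpr ⟨_, congrArg Subtype.val (harrow z)⟩
  · have hepi : Epi (Subobject.ofLE S T hle) := by
      refine epi_of_app_surjective hb _ fun z => ?_
      obtain ⟨y, hy⟩ := (mem_valueSubmodule S.arrow).mp
        (hge ((mem_valueSubmodule T.arrow).mpr ⟨z, rfl⟩))
      refine ⟨y, app_injective_of_mono (b := b) T.arrow ?_⟩
      rw [harrow]
      exact Subtype.ext hy
    have := isIso_of_mono_of_epi (Subobject.ofLE S T hle)
    exact Subobject.le_of_comm (inv (Subobject.ofLE S T hle)) (by simp)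

/-- If `C` has a `d`-fold generator whose endomorphisms are a finitely generated module over a
central algebra essentially of finite type over the noetherian ring `k`, then `P_{d;k}(C, k)` is
locally noetherian. -/
theorem isLocallyNoetherian [IsNoetherianRing k] [Algebra.EssFiniteType k A] {b : C}
    (hb : IsFoldGenerator d b) [IsScalarTower k A (b ⟶ b)] [Module.Finite A (b ⟶ b)] :
    IsLocallyNoetherian.{w} (StrictPolynomialFunctor k d C (ModuleCat.{u} k)) := by
  refine ⟨PUnit, fun _ => representable k d b, fun _ => ?_, isSeparating_representable hb⟩
  have := wellFoundedGT_stableSubmodule (k := k) (V := (b ⟶ b)) (A := A) d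
  exact ⟨(stableSubmodule_strictMono (A := A) hb).wellFoundedGT⟩

end StrictPolynomialFunctor

/-! ### Projective modules -/

namespace FGProjRight

variable (L : Type u) [Ring L]

/-- The free right module of rank `d`. -/
def free (d : ℕ) : FGProjRight L where
  obj := ModuleCat.of Lᵐᵒᵖ (Fin d → Lᵐᵒᵖ)
  property := ⟨inferInstanceAs (Module.Finite Lᵐᵒᵖ (Fin d → Lᵐᵒᵖ)),
    inferInstanceAs (Module.Projective Lᵐᵒᵖ (Fin d → Lᵐᵒᵖ))⟩

/-- `M` is a summand of some `L^r`, and `f i` is the passage through the `i`-th coordinate. Any `d`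
of these only need `d` coordinates, which a single map to `L^d` records. -/
lemma isFoldGenerator_free (d : ℕ) : IsFoldGenerator d (free L d) := by
  intro M
  obtain ⟨_, _⟩ := M.property
  obtain ⟨r, f, g, -, -, hfg⟩ := Module.Finite.exists_comp_eq_id_of_projective Lᵐᵒᵖ M.obj
  refine ⟨r, fun i => ObjectProperty.homMk (ModuleCat.ofHom
    (f ∘ₗ LinearMap.single Lᵐᵒᵖ (fun _ => Lᵐᵒᵖ) i ∘ₗ LinearMap.proj i ∘ₗ g)), ?_, fun τ => ?_⟩
  · have hsum : ∑ i, (f ∘ₗ LinearMap.single Lᵐᵒᵖ (fun _ => Lᵐᵒᵖ) i ∘ₗ LinearMap.proj i ∘ₗ g) =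
        LinearMap.id := by
      rw [← hfg]
      ext x
      simp only [LinearMap.sum_apply, LinearMap.comp_apply, ← map_sum, LinearMap.proj_apply,
        LinearMap.coe_single, Finset.univ_sum_single]
    let e : (M.obj →ₗ[Lᵐᵒᵖ] M.obj) →+ (M ⟶ M) :=
      { toFun := fun h => ObjectProperty.homMk (ModuleCat.ofHom h)
        map_zero' := rfl
        map_add' := fun _ _ => rfl }
    exact (map_sum e _ _).symm.trans (congrArg e hsum)
  · refine ⟨ObjectProperty.homMk (ModuleCat.ofHom (LinearMap.funLeft Lᵐᵒᵖ Lᵐᵒᵖ τ ∘ₗ g)),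
      fun c => ⟨ObjectProperty.homMk (ModuleCat.ofHom
        (f ∘ₗ LinearMap.single Lᵐᵒᵖ (fun _ => Lᵐᵒᵖ) (τ c) ∘ₗ LinearMap.proj c)), rfl⟩⟩

variable (A : Type v) [CommRing A] [Algebra A L]

open scoped ModuleCat.Algebra in
/-- The linear structure of the category of right modules over an algebra. -/
abbrev linear : Linear A (FGProjRight L) := inferInstance

/-- The `k`-linear structure comes from `k → L` directly and not by restriction along `k → A`, so
the compatibility has to be checked. -/
lemma isScalarTower_hom (k : Type u) [CommRing k] [Algebra k L] [Algebra k A]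
    [IsScalarTower k A L] (M N : FGProjRight L) :
    letI := linear L A
    IsScalarTower k A (M ⟶ N) :=
  let _ := linear L A
  ⟨fun r a f => by
    refine ObjectProperty.hom_ext _ (ModuleCat.hom_ext (LinearMap.ext fun x => ?_))
    change MulOpposite.op (algebraMap A L (r • a)) • f.hom.hom x =
      MulOpposite.op (algebraMap k L r) • MulOpposite.op (algebraMap A L a) • f.hom.hom x
    rw [smul_smul, ← MulOpposite.op_mul, Algebra.smul_def, map_mul,
      ← IsScalarTower.algebraMap_apply, Algebra.commutes]⟩

/-- Endomorphisms of `L^d` are given by `d × d` matrices over `L`, so they form an `A`-linear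
quotient of a finite power of `L`. -/
lemma finite_end_free [Module.Finite A L] (d : ℕ) :
    letI := linear L A
    Module.Finite A (free L d ⟶ free L d) := by
  let _ := linear L A
  have : Module.Finite A Lᵐᵒᵖ := Module.Finite.equiv (MulOpposite.opLinearEquiv A)
  let e : (Fin d → Fin d → Lᵐᵒᵖ) →ₗ[A] (free L d ⟶ free L d) :=
    { toFun := fun h => ObjectProperty.homMk (ModuleCat.ofHom
        ((Pi.basisFun Lᵐᵒᵖ (Fin d)).constr A h))
      map_add' := fun g h => by
        rw [map_add]
        rfl
      map_smul' := fun a h => by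
        rw [map_smul]
        refine ObjectProperty.hom_ext _ (ModuleCat.hom_ext (LinearMap.ext fun x => ?_))
        exact algebra_compatible_smul Lᵐᵒᵖ a
          ((Pi.basisFun Lᵐᵒᵖ (Fin d)).constr A h x : Fin d → Lᵐᵒᵖ) }
  refine Module.Finite.of_surjective e fun f => ⟨fun i => f.hom.hom (Pi.single i 1), ?_⟩
  refine ObjectProperty.hom_ext _ (ModuleCat.hom_ext ?_)
  refine (Pi.basisFun Lᵐᵒᵖ (Fin d)).ext fun i => ?_
  have h := (Pi.basisFun Lᵐᵒᵖ (Fin d)).constr_basis (M' := Fin d → Lᵐᵒᵖ) A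
    (fun i => f.hom.hom (Pi.single i 1)) i
  exact h.trans (by rw [Pi.basisFun_apply]; rfl)

end FGProjRight

end

theorem mainTheorem3 (k : Type u) [CommRing k] [IsNoetherianRing k]
    (A : Type v) [CommRing A] [Algebra k A] [Algebra.EssFiniteType k A]
    (L : Type u) [Ring L] [Algebra k L] [Algebra A L] [IsScalarTower k A L] [Module.Finite A L]
    (d : ℕ) :
    IsLocallyNoetherian.{u}
      (StrictPolynomialFunctor k d (FGProjRight L) (ModuleCat.{u} k)) := by
  let _ := FGProjRight.linear L A
  have := FGProjRight.isScalarTower_hom L A k (FGProjRight.free L d) (FGProjRight.free L d)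
  have := FGProjRight.finite_end_free L A d
  exact StrictPolynomialFunctor.isLocallyNoetherian (A := A) (FGProjRight.isFoldGenerator_free L d)
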